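/- **Setting.** Let $N\ge 1$, let $\tau$ be a partition of $N$ with first part $\tau_1$ and $\ell(\tau)$ parts, let $\mathbb K$ be a field, and let $q,t\in\mathbb K\setminus\{0\}$ satisfy $q^at^b\neq 1$ for all integers $a\ge 0$ and $b$ with $|b|\le \tau_1+\ell(\tau)-2$ and $(a,b)\ne(0,0)$. All operators are written on the right of their arguments, so the leftmost factor of a product acts first. *Tableaux.* $\mathcal Y(\tau)$ is the set of fillings $S$ of the Ferrers diagram of $\tau$ by $1,\dots,N$ (each used once) whose entries decrease along rows and down columns; $c(i,S)$ is the column minus the row of the entry $i$ in $S$, and $V_\tau$ is the $\mathbb K$-space with basis $\mathcal Y(\tau)$. Put $u(z)=\frac{(t-z)(1-tz)}{(1-z)^2}$. For $1\le i<N$ define $\tau(T_i)$ on $V_\tau$ as follows: $S\tau(T_i)=tS$ if $i,i+1$ are in the same row of $S$; $S\tau(T_i)=-S$ if they are in the same column; otherwise let $S^{(i)}$ be $S$ with $i$ and $i+1$ exchanged, let $b=c(i,S)-c(i+1,S)$, and $$S\tau(T_i)=S^{(i)}+\tfrac{t-1}{1-t^{-b}}S\ \ (b\ge 2),\qquad S\tau(T_i)=\tfrac{t(t^{b+1}-1)(t^{b-1}-1)}{(t^b-1)^2}S^{(i)}+\tfrac{t^b(t-1)}{t^b-1}S\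 \ (b\le -2).$$ Let $\tau(\omega)=\tau(T_1)\tau(T_2)\cdots\tau(T_{N-1})$ and $\langle S,S'\rangle_0=\delta_{S,S'}\prod_{i<j,\ c(j,S)-c(i,S)\ge2}u\big(t^{c(i,S)-c(j,S)}\big)$. *Operators.* Let $\mathcal P=\mathbb K[x_1,\dots,x_N]$ and $\mathcal P_\tau=\mathcal P\otimes V_\tau$. With $s_i$ interchanging the entries number $i$ and $i+1$ of a tuple, put $$(p\otimes S)\boldsymbol T_i=(1-t)x_{i+1}\frac{p(x)-p(x.s_i)}{x_i-x_{i+1}}\otimes S+p(x.s_i)\otimes S\tau(T_i),$$ $$(p\otimes S)\boldsymbol w=p(qx_N,x_1,\dots,x_{N-1})\otimes S\tau(\omega),\qquad \boldsymbol\xi_N=\boldsymbol T_{N-1}^{-1}\cdots\boldsymbol T_1^{-1}\boldsymbol w,$$ $$\boldsymbol w^*=\boldsymbol T_{N-1}^{-1}\cdots\boldsymbol T_1^{-1}\boldsymbol w\boldsymbol T_{N-1}\cdots\boldsymbol T_1,\qquad f\mathcal D_N=(f-f\boldsymbol\xi_N)/x_N .$$ *Macdonald polynomials.* For $\alpha\in\mathbb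 N_0^N$ let $\alpha^+$ be its nonincreasing rearrangement, $r_\alpha(i)=\#\{j:\alpha_j>\alpha_i\}+\#\{j\le i:\alpha_j=\alpha_i\}$, $\alpha\Phi=(\alpha_2,\dots,\alpha_N,\alpha_1+1)$, and $\zeta_{\alpha,S}(i)=q^{\alpha_i}t^{c(r_\alpha(i),S)}$. The nonsymmetric vector-valued Macdonald polynomials $M_{\alpha,S}\in\mathcal P_\tau$ ($\alpha\in\mathbb N_0^N$, $S\in\mathcal Y(\tau)$) are those generated from $M_{\boldsymbol 0,S}=1\otimes S$ by the steps of the Yang–Baxter graph $$M_{\alpha\Phi,S}=x_N\,(M_{\alpha,S}\boldsymbol w),\qquad M_{\alpha.s_i,S}=M_{\alpha,S}\boldsymbol T_i+\frac{t-1}{\zeta_{\alpha,S}(i+1)/\zeta_{\alpha,S}(i)-1}M_{\alpha,S}\quad\text{if }\alpha_i<\alpha_{i+1}$$ (the result does not depend on the chosen path; to fix one, the last nonzero entry of an index is moved to position $N$, where the affine step applies). *Hypotheses (BF2).* $\langle\cdot,\cdot\rangle$ is a symmetric bilinear form on $\mathcal P_\tau$ such that for all $f,g\in\mathcal P_\tau$,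 $S,S'\in\mathcal Y(\tau)$ and $1\le i<N$: $$\langle1\otimes S,1\otimes S'\rangle=\langle S,S'\rangle_0,\quad \langle f\boldsymbol T_i,g\rangle=\langle f,g\boldsymbol T_i\rangle,\quad \langle f\boldsymbol\xi_N,g\rangle=\langle f,g\boldsymbol\xi_N\rangle,\quad \langle f\mathcal D_N,g\rangle=(1-q)\langle f,x_N(g\boldsymbol w^*\boldsymbol w)\rangle .$$ Write $\|f\|^2=\langle f,f\rangle$. **Proposition.** Suppose (BF2) holds. Then for all $\alpha\in\mathbb N_0^N$ and $S\in\mathcal Y(\tau)$, $$\|M_{\alpha^+,S}\|^2=\mathcal E(\alpha,S)\,\|M_{\alpha,S}\|^2,\qquad \mathcal E(\alpha,S)=\prod_{1\le i<j\le N,\ \alpha_i<\alpha_j}u\Big(q^{\alpha_j-\alpha_i}\,t^{\,c(r_\alpha(j),S)-c(r_\alpha(i),S)}\Big),$$ $$\|M_{\alpha\Phi,S}\|^2=\frac{1-q^{\alpha_1+1}\,t^{\,c(r_\alpha(1),S)}}{1-q}\,\|M_{\alpha,S}\|^2 .$$ -/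

import Mathlib

open scoped TensorProduct
open Finset

/-! The number of variables is `N = n + 1`.  Positions `1, …, N`, and the entries `1, …, N` of
tableaux, are indexed by `Fin (n + 1)` starting from `0`; the generators `T_1, …, T_{N-1}` are
indexed by `i : Fin n`, which stands for the adjacent pair `i.castSucc`, `i.succ`.  Operators that
the literature writes on the right (`f T_1 T_2`: first `T_1`, then `T_2`) are ordinary linear
maps here, so that products appear in reversed order. -/

namespace VVMac

/-! ### Compositions -/

/-- `r_α(i) = #{j : α_j > α_i} + #{j ≤ i : α_j = α_i}`, shifted to start from `0`. -/
def rank {n : ℕ} (α : Fin (n + 1) → ℕ) (i : Fin (n + 1)) : Fin (n + 1) :=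
  ⟨(univ.filter fun j => α i < α j).card + (univ.filter fun j => j < i ∧ α j = α i).card, by
    rw [← card_union_of_disjoint]
    · refine lt_of_lt_of_eq (card_lt_card (t := univ) ?_) (by simp)
      refine (ssubset_univ_iff).2 fun h => ?_
      have := mem_univ i
      rw [← h] at this
      simp at this
    · rw [disjoint_filter]
      intro j _ h1 h2
      omega⟩

/-- `α⁺`, the nonincreasing rearrangement of `α`. -/
def plus {n : ℕ} (α : Fin (n + 1) → ℕ) : Fin (n + 1) → ℕ :=
  fun i => α (Tuple.sort α i.rev)

/-- `α.s_i`: the entries number `i` and `i + 1` are interchanged. -/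
def swapAt {n : ℕ} (α : Fin (n + 1) → ℕ) (i : Fin n) : Fin (n + 1) → ℕ :=
  fun k => α (Equiv.swap i.castSucc i.succ k)

/-- `αΦ = (α_2, …, α_N, α_1 + 1)`. -/
def affine {n : ℕ} (α : Fin (n + 1) → ℕ) : Fin (n + 1) → ℕ :=
  Fin.snoc (α := fun _ => ℕ) (fun i : Fin n => α i.succ) (α 0 + 1)

/-- `(α_N - 1, α_1, …, α_{N-1})`, which inverts `Φ` when `α_N ≥ 1`. -/
def affineInv {n : ℕ} (α : Fin (n + 1) → ℕ) : Fin (n + 1) → ℕ :=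
  Fin.cons (α := fun _ => ℕ) (α (Fin.last n) - 1) (fun i : Fin n => α i.castSucc)

/-! ### Reverse standard Young tableaux -/

/-- Reverse standard Young tableaux of shape `μ` with entries `1, …, N`: every box of `μ` gets
exactly one entry, and entries decrease along each row and down each column.  `pos k` is the
box (row, column) that holds the entry `k`. -/
@[ext]
structure RSYT (μ : YoungDiagram) (n : ℕ) where
  pos : Fin (n + 1) ≃ {c : ℕ × ℕ // c ∈ μ.cells}
  row_decr : ∀ k l, (pos k).1.1 = (pos l).1.1 → (pos k).1.2 < (pos l).1.2 → l < k
  col_decr : ∀ k l, (pos k).1.2 = (pos l).1.2 → (pos k).1.1 < (pos l).1.1 → l < k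

namespace RSYT

variable {μ : YoungDiagram} {n : ℕ}

/-- The row of the entry `k`. -/
def row (S : RSYT μ n) (k : Fin (n + 1)) : ℕ := (S.pos k).1.1

/-- The column of the entry `k`. -/
def col (S : RSYT μ n) (k : Fin (n + 1)) : ℕ := (S.pos k).1.2

/-- The content `c(k, S) = col(k, S) - row(k, S)`. -/
def content (S : RSYT μ n) (k : Fin (n + 1)) : ℤ := (S.col k : ℤ) - (S.row k : ℤ)

theorem lt_of_swap_lt (i : Fin n) (k l : Fin (n + 1))
    (h : Equiv.swap i.castSucc i.succ l < Equiv.swap i.castSucc i.succ k)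
    (hne : ¬ (k = i.castSucc ∧ l = i.succ)) : l < k := by
  rw [Equiv.swap_apply_def, Equiv.swap_apply_def] at h
  simp only [Fin.ext_iff, Fin.lt_def, Fin.val_castSucc, Fin.val_succ] at h hne ⊢
  split_ifs at h <;> (try simp only [Fin.val_castSucc, Fin.val_succ] at h) <;> omega

/-- `S^{(i)}`: the entries `i` and `i + 1`, which lie in different rows and columns, are
exchanged. -/
def exchange (S : RSYT μ n) (i : Fin n) (hr : S.row i.castSucc ≠ S.row i.succ)
    (hc : S.col i.castSucc ≠ S.col i.succ) : RSYT μ n where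
  pos := (Equiv.swap i.castSucc i.succ).trans S.pos
  row_decr k l h1 h2 := by
    refine lt_of_swap_lt i k l (S.row_decr _ _ h1 h2) ?_
    rintro ⟨rfl, rfl⟩
    simp only [Equiv.trans_apply, Equiv.swap_apply_left, Equiv.swap_apply_right] at h1
    exact hr h1.symm
  col_decr k l h1 h2 := by
    refine lt_of_swap_lt i k l (S.col_decr _ _ h1 h2) ?_
    rintro ⟨rfl, rfl⟩
    simp only [Equiv.trans_apply, Equiv.swap_apply_left, Equiv.swap_apply_right] at h1
    exact hc h1.symm

end RSYT

/-! ### The Hecke algebra module `V_τ` -/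

section

variable {K : Type*} [Field K]

/-- `u(z) = (t - z)(1 - t z) / (1 - z)²`. -/
def u (t z : K) : K := (t - z) * (1 - t * z) / (1 - z) ^ 2

/-- `V_τ`, the vector space with basis the tableaux. -/
abbrev V (K : Type*) [Field K] (μ : YoungDiagram) (n : ℕ) : Type _ := RSYT μ n →₀ K

variable {μ : YoungDiagram} {n : ℕ}

/-- `S τ(T_i)` for a tableau `S`.  If the entries `i`, `i + 1` are in different rows and columns
and `row i < row (i+1)`, then `c(i) - c(i+1) ≥ 2`; otherwise `c(i) - c(i+1) ≤ -2`. -/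
noncomputable def tauBasis (t : K) (i : Fin n) (S : RSYT μ n) : V K μ n :=
  if hr : S.row i.castSucc = S.row i.succ then t • Finsupp.single S 1
  else if hc : S.col i.castSucc = S.col i.succ then -Finsupp.single S 1
  else if S.row i.castSucc < S.row i.succ then
    Finsupp.single (S.exchange i hr hc) 1
      + ((t - 1) / (1 - t ^ (S.content i.succ - S.content i.castSucc))) • Finsupp.single S 1
  else
    (t * (t ^ (S.content i.castSucc - S.content i.succ + 1) - 1)
        * (t ^ (S.content i.castSucc - S.content i.succ - 1) - 1)
        / (t ^ (S.content i.castSucc - S.content i.succ) - 1) ^ 2)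
      • Finsupp.single (S.exchange i hr hc) 1
    + (t ^ (S.content i.castSucc - S.content i.succ) * (t - 1)
        / (t ^ (S.content i.castSucc - S.content i.succ) - 1)) • Finsupp.single S 1

/-- The operator `τ(T_i)` on `V_τ`. -/
noncomputable def tau (t : K) (i : Fin n) : Module.End K (V K μ n) :=
  Finsupp.linearCombination K (tauBasis t i)

/-- `τ(ω)` with `ω = T_1 T_2 ⋯ T_{N-1}`, `T_1` acting first. -/
noncomputable def tauOmega (t : K) : Module.End K (V K μ n) :=
  ((List.finRange n).map (tau t)).reverse.prod

open Classical in
/-- `⟨S, S'⟩_0 = δ_{S,S'} ∏_{i<j, c(j,S) - c(i,S) ≥ 2} u(t^{c(i,S) - c(j,S)})`. -/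
noncomputable def form0 (t : K) (S S' : RSYT μ n) : K :=
  if S = S' then
    ∏ p ∈ (univ : Finset (Fin (n + 1) × Fin (n + 1))).filter
        (fun p => p.1 < p.2 ∧ 2 ≤ S.content p.2 - S.content p.1),
      u t (t ^ (S.content p.1 - S.content p.2))
  else 0

/-! ### Operators on polynomials -/

/-- `𝒫 = K[x_1, …, x_N]`. -/
abbrev P (K : Type*) [Field K] (n : ℕ) : Type _ := MvPolynomial (Fin (n + 1)) K

/-- `p(x) ↦ p(x.s_i)`. -/
noncomputable def sOp (K : Type*) [Field K] {n : ℕ} (i : Fin n) : P K n →ₐ[K] P K n :=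
  MvPolynomial.rename (Equiv.swap i.castSucc i.succ)

theorem dvd_sub_sOp (i : Fin n) (p : P K n) :
    (MvPolynomial.X i.castSucc - MvPolynomial.X i.succ : P K n) ∣ p - sOp K i p := by
  induction p using MvPolynomial.induction_on with
  | C a => simp [sOp]
  | add p q hp hq =>
    rw [map_add, add_sub_add_comm]
    exact dvd_add hp hq
  | mul_X p j hp =>
    have hX : (MvPolynomial.X i.castSucc - MvPolynomial.X i.succ : P K n) ∣
        MvPolynomial.X j - sOp K i (MvPolynomial.X j) := by
      simp only [sOp, MvPolynomial.rename_X, Equiv.swap_apply_def]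
      split_ifs with h1 h2
      · subst h1; exact dvd_rfl
      · subst h2
        exact ⟨-1, by ring⟩
      · simp
    have : p * MvPolynomial.X j - sOp K i (p * MvPolynomial.X j)
        = (p - sOp K i p) * MvPolynomial.X j
          + sOp K i p * (MvPolynomial.X j - sOp K i (MvPolynomial.X j)) := by
      rw [map_mul]; ring
    rw [this]
    exact dvd_add (hp.mul_right _) (hX.mul_left _)

theorem X_sub_X_ne_zero (i : Fin n) :
    (MvPolynomial.X i.castSucc - MvPolynomial.X i.succ : P K n) ≠ 0 := by
  rw [sub_ne_zero]
  intro h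
  have := MvPolynomial.X_injective h
  simp [Fin.ext_iff] at this

/-- The divided difference `p ↦ (p(x) - p(x.s_i)) / (x_i - x_{i+1})` (exact division). -/
noncomputable def divDiff (K : Type*) [Field K] {n : ℕ} (i : Fin n) : P K n →ₗ[K] P K n where
  toFun p := (dvd_sub_sOp i p).choose
  map_add' p q := by
    apply mul_left_cancel₀ (X_sub_X_ne_zero (K := K) i)
    rw [mul_add, ← (dvd_sub_sOp i (p + q)).choose_spec, ← (dvd_sub_sOp i p).choose_spec,
      ← (dvd_sub_sOp i q).choose_spec, map_add]
    ring
  map_smul' c p := by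
    apply mul_left_cancel₀ (X_sub_X_ne_zero (K := K) i)
    rw [RingHom.id_apply, mul_smul_comm, ← (dvd_sub_sOp i (c • p)).choose_spec,
      ← (dvd_sub_sOp i p).choose_spec, map_smul, smul_sub]

theorem divDiff_spec (i : Fin n) (p : P K n) :
    (MvPolynomial.X i.castSucc - MvPolynomial.X i.succ) * divDiff K i p = p - sOp K i p :=
  (dvd_sub_sOp i p).choose_spec.symm

/-- `p(x) ↦ p(q x_N, x_1, …, x_{N-1})`. -/
noncomputable def shiftOp (q : K) (n : ℕ) : P K n →ₐ[K] P K n :=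
  MvPolynomial.aeval
    (Fin.cons (α := fun _ => P K n) (MvPolynomial.C q * MvPolynomial.X (Fin.last n))
      (fun i : Fin n => MvPolynomial.X i.castSucc))

/-- Division by `x_N`: the quotient of `p` by `x_N` whenever `x_N` divides `p` (in general the
monomials not divisible by `x_N` are dropped). -/
noncomputable def divXLast (K : Type*) [Field K] (n : ℕ) : P K n →ₗ[K] P K n where
  toFun p := MvPolynomial.divMonomial p (Finsupp.single (Fin.last n) 1)
  map_add' p q := MvPolynomial.add_divMonomial p q _
  map_smul' c p := by
    ext m
    simp [MvPolynomial.coeff_divMonomial]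

/-! ### Operators on vector-valued polynomials -/

/-- `𝒫_τ = 𝒫 ⊗ V_τ`. -/
abbrev PV (K : Type*) [Field K] (μ : YoungDiagram) (n : ℕ) : Type _ := P K n ⊗[K] V K μ n

/-- `p ⊗ S` for a polynomial `p` and a tableau `S`. -/
noncomputable def pureTensor (p : P K n) (S : RSYT μ n) : PV K μ n := p ⊗ₜ[K] Finsupp.single S 1

/-- `(p ⊗ S) T_i = (1 - t) x_{i+1} (p - p s_i)/(x_i - x_{i+1}) ⊗ S + p s_i ⊗ S τ(T_i)`. -/
noncomputable def T (t : K) (i : Fin n) : Module.End K (PV K μ n) :=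
  TensorProduct.map
      ((1 - t) • LinearMap.mulLeft K (MvPolynomial.X i.succ : P K n) ∘ₗ divDiff K i) LinearMap.id
    + TensorProduct.map (sOp K i).toLinearMap (tau t i)

/-- `T_i^{-1} = t^{-1} (T_i + 1 - t)`. -/
noncomputable def Tinv (t : K) (i : Fin n) : Module.End K (PV K μ n) :=
  t⁻¹ • (T t i + (1 - t) • 1)

/-- `(p ⊗ S) w = p(q x_N, x_1, …, x_{N-1}) ⊗ S τ(ω)`. -/
noncomputable def w (q t : K) : Module.End K (PV K μ n) :=
  TensorProduct.map (shiftOp q n).toLinearMap (tauOmega t)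

/-- Multiplication by `x_N`. -/
noncomputable def mulXLast : Module.End K (PV K μ n) :=
  TensorProduct.map (LinearMap.mulLeft K (MvPolynomial.X (Fin.last n) : P K n)) LinearMap.id

/-- `T_{N-1} T_{N-2} ⋯ T_1`, `T_{N-1}` acting first. -/
noncomputable def Tdesc (t : K) : Module.End K (PV K μ n) :=
  ((List.finRange n).map (T t)).prod

/-- `T_{N-1}^{-1} T_{N-2}^{-1} ⋯ T_1^{-1}`, `T_{N-1}^{-1}` acting first. -/
noncomputable def TinvDesc (t : K) : Module.End K (PV K μ n) :=
  ((List.finRange n).map (Tinv t)).prod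

/-- The Cherednik operator `ξ_N = T_{N-1}^{-1} ⋯ T_1^{-1} w`. -/
noncomputable def xiLast (q t : K) : Module.End K (PV K μ n) := w q t * TinvDesc t

/-- `w^* = T_{N-1}^{-1} ⋯ T_1^{-1} w T_{N-1} ⋯ T_1`. -/
noncomputable def wStar (q t : K) : Module.End K (PV K μ n) :=
  Tdesc t * w q t * TinvDesc t

/-- The Dunkl operator `f 𝒟_N = (f - f ξ_N) / x_N`.  The division is exact: at `x_i = 0` the
operator `T_i^{-1}` acts as `s_i ⊗ τ(T_i)^{-1}`, hence `ξ_N` acts as the identity at `x_N = 0`. -/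
noncomputable def dunklLast (q t : K) : Module.End K (PV K μ n) :=
  TensorProduct.map (divXLast K n) LinearMap.id ∘ₗ (1 - xiLast q t)

/-! ### The Macdonald polynomials -/

/-- The spectral vector `ζ_{α,S}(i) = q^{α_i} t^{c(r_α(i), S)}`. -/
def zeta (q t : K) (α : Fin (n + 1) → ℕ) (S : RSYT μ n) (i : Fin (n + 1)) : K :=
  q ^ α i * t ^ S.content (rank α i)

/-- The step `s_i` of the Yang–Baxter graph, at the node labelled `(α, S)` with
`α_i < α_{i+1}`: `f ↦ f T_i + (t - 1) / (ζ_{α,S}(i+1) / ζ_{α,S}(i) - 1) f`. -/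
noncomputable def ybStep (q t : K) (α : Fin (n + 1) → ℕ) (S : RSYT μ n) (i : Fin n)
    (f : PV K μ n) : PV K μ n :=
  T t i f + ((t - 1) / (zeta q t α S i.succ / zeta q t α S i.castSucc - 1)) • f

theorem sum_affineInv_lt (α : Fin (n + 1) → ℕ) (h : α (Fin.last n) ≠ 0) :
    ∑ i, affineInv α i < ∑ i, α i := by
  rw [Fin.sum_univ_succ, Fin.sum_univ_castSucc]
  simp only [affineInv, Fin.cons_zero, Fin.cons_succ]
  omega

theorem sum_swapAt (α : Fin (n + 1) → ℕ) (i : Fin n) : ∑ k, swapAt α i k = ∑ k, α k :=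
  Equiv.sum_comp (Equiv.swap i.castSucc i.succ) α

theorem weight_swapAt_lt (α : Fin (n + 1) → ℕ) (i : Fin n) (h : α i.succ < α i.castSucc) :
    ∑ k : Fin (n + 1), swapAt α i k * (n - (k : ℕ)) < ∑ k : Fin (n + 1), α k * (n - (k : ℕ)) := by
  have hne : i.castSucc ≠ i.succ := (Fin.castSucc_lt_succ).ne
  have hmem : i.succ ∈ univ.erase i.castSucc := mem_erase.2 ⟨hne.symm, mem_univ _⟩
  rw [← add_sum_erase univ _ (mem_univ i.castSucc), ← add_sum_erase univ (fun k => α k * _)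
    (mem_univ i.castSucc), ← add_sum_erase _ _ hmem, ← add_sum_erase _ (fun k => α k * _) hmem]
  have hrest : ∑ k ∈ (univ.erase i.castSucc).erase i.succ, swapAt α i k * (n - (k : ℕ))
      = ∑ k ∈ (univ.erase i.castSucc).erase i.succ, α k * (n - (k : ℕ)) := by
    refine sum_congr rfl fun k hk => ?_
    simp only [mem_erase] at hk
    simp [swapAt, Equiv.swap_apply_of_ne_of_ne hk.2.1 hk.1]
  rw [hrest]
  simp only [swapAt, Equiv.swap_apply_left, Equiv.swap_apply_right, Fin.val_castSucc,
    Fin.val_succ]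
  obtain ⟨m, hm⟩ : ∃ m, n - (i : ℕ) = m + 1 := ⟨n - i - 1, by omega⟩
  have hm' : n - ((i : ℕ) + 1) = m := by omega
  rw [hm, hm', ← add_assoc, ← add_assoc]
  refine Nat.add_lt_add_right ?_ _
  nlinarith

open Classical in
/-- The Macdonald polynomial `M_{α,S}`, built along the Yang–Baxter graph from `M_{0,S} = 1 ⊗ S`.
If `α_N ≥ 1` then `α = βΦ` and `M_{α,S} = x_N (M_{β,S} w)` (affine step).  If `α_N = 0` and
`α_i` is the last nonzero entry of `α`, then `β = α.s_i` has `β_i < β_{i+1}`, and `M_{α,S}` arises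
from `M_{β,S}` by the step `s_i`.  (The result does not depend on the path in the graph, by the
braid relations.) -/
noncomputable def M (q t : K) (α : Fin (n + 1) → ℕ) (S : RSYT μ n) : PV K μ n :=
  if α (Fin.last n) ≠ 0 then mulXLast (w q t (M q t (affineInv α) S))
  else if h : ∃ i : Fin n, α i.castSucc ≠ 0 ∧ ∀ j, i.castSucc < j → α j = 0 then
    ybStep q t (swapAt α h.choose) S h.choose (M q t (swapAt α h.choose) S)
  else pureTensor 1 S
termination_by (∑ i, α i, ∑ i : Fin (n + 1), α i * (n - (i : ℕ)))
decreasing_by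
  · exact Prod.Lex.left _ _ (sum_affineInv_lt α ‹_›)
  · rw [sum_swapAt]
    refine Prod.Lex.right _ (weight_swapAt_lt α _ ?_)
    have h1 := h.choose_spec.1
    have h2 := h.choose_spec.2 _ (Fin.castSucc_lt_succ (i := h.choose))
    omega

/-- `ℰ(α, S) = ∏_{i<j, α_i<α_j} u(q^{α_j - α_i} t^{c(r_α(j), S) - c(r_α(i), S)})`. -/
def E (q t : K) (α : Fin (n + 1) → ℕ) (S : RSYT μ n) : K :=
  ∏ p ∈ (univ : Finset (Fin (n + 1) × Fin (n + 1))).filter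
      (fun p => p.1 < p.2 ∧ α p.1 < α p.2),
    u t (q ^ (α p.2 - α p.1) * t ^ (S.content (rank α p.2) - S.content (rank α p.1)))

/-- The hypotheses (called BF2) on a symmetric bilinear form on `𝒫_τ`. -/
structure BF2 (q t : K) (B : LinearMap.BilinForm K (PV K μ n)) : Prop where
  symm : ∀ f g, B f g = B g f
  const : ∀ S S' : RSYT μ n, B (pureTensor 1 S) (pureTensor 1 S') = form0 t S S'
  hecke : ∀ (i : Fin n) (f g), B (T t i f) g = B f (T t i g)
  cherednik : ∀ f g, B (xiLast q t f) g = B f (xiLast q t g)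
  dunkl : ∀ f g, B (dunklLast q t f) g = (1 - q) * B f (mulXLast (w q t (wStar q t g)))

end

end VVMac

namespace VVMac

/-! The Macdonald polynomial `M q t α S` is a joint eigenvector of the Cherednik operators ξ_i,
defined by ξ_i = t⁻¹ T_i ξ_{i+1} T_i, with eigenvalues ζ_{α,S}(i) (`isSpectral_M`). Under BF2 every
ξ_i is self-adjoint, so eigenvectors that differ in one eigenvalue are orthogonal
(`BF2.orthogonal`).

For a step s_i with α_i < α_{i+1}, let f and g be the polynomials at α and α.s_i, let z =
ζ(i+1)/ζ(i) and b = (t-1)/(z-1). Then g = T_i f + b f and f ⟂ g, so ⟨g,g⟩ = ⟨T_i f, g⟩ = ⟨f, T_i g⟩.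
By the quadratic relation, T_i g is a multiple of g plus (t - b(t-1+b)) f, and this last coefficient
is u(z). The same step removes exactly the factor u(z) from ℰ, so sorting α gives the first formula.

For the affine step, the Dunkl relation is evaluated at x_N (w f), which is the polynomial at αΦ,
and at f with T_1, then T_2, …, then T_{N-1} applied. The first vector has ξ_N-eigenvalue qζ(1), so
𝒟_N maps it to (1 - qζ(1)) w f. In the second, w^* cancels the T_i against its inverses and returns
t^{N-1} ξ_1 f. Both sides then carry the factor t^{N-1} ζ(1), and cancelling it gives the second
formula.

Two facts support this. The eigenvector property needs the Hecke relations: they are verified for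
the seminormal formulas, carried to polynomials by induction on the degree, and used in the abstract
form `IsAffineHecke`. Moreover `M` is defined along one path of the Yang–Baxter graph, whereas
sorting needs the step at an arbitrary ascent. `M_eq_ybStep` supplies it by comparing paths locally,
with the Yang–Baxter relation `ybStep_braid` as the essential case. -/

/-! ### The Hecke relations -/

/-- The relations of the Hecke algebra of type `A`. -/
structure IsHecke {K A : Type*} [Field K] [Ring A] [Algebra K A] {n : ℕ} (t : K)
    (T : Fin n → A) : Prop where
  quad : ∀ i, T i * T i = (t - 1) • T i + t • (1 : A)
  braid : ∀ i j : Fin n, (i : ℕ) + 1 = j → T i * T j * T i = T j * T i * T j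
  comm : ∀ i j : Fin n, (i : ℕ) + 1 < j → T i * T j = T j * T i

/-! ### Combinatorics of tableaux -/

section Tableaux

variable {μ : YoungDiagram} {n : ℕ}

/-- The content of a box. -/
def boxContent (x : ℕ × ℕ) : ℤ := (x.2 : ℤ) - (x.1 : ℤ)

/-- `q ^ a * t ^ b ≠ 1` for all exponents that arise from the diagram `μ`. -/
structure Generic {K : Type*} [Field K] (q t : K) (μ : YoungDiagram) : Prop where
  q_ne_zero : q ≠ 0
  t_ne_zero : t ≠ 0
  ne_one : ∀ (a : ℕ) (x y : ℕ × ℕ), x ∈ μ → y ∈ μ → a ≠ 0 ∨ boxContent x ≠ boxContent y →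
    q ^ a * t ^ (boxContent x - boxContent y) ≠ 1

theorem Generic.zpow_ne {K : Type*} [Field K] {q t : K} (h : Generic q t μ) {x y : ℕ × ℕ}
    (hx : x ∈ μ) (hy : y ∈ μ) (hxy : boxContent x ≠ boxContent y) :
    t ^ boxContent x ≠ t ^ boxContent y := by
  intro he
  refine h.ne_one 0 x y hx hy (Or.inr hxy) ?_
  rw [zpow_sub₀ h.t_ne_zero, he, pow_zero, one_mul, div_self (zpow_ne_zero _ h.t_ne_zero)]

/-- The first row and first column bound all coordinates, so contents lie between 1 - ℓ(τ) and τ_1 -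
1 and differ by at most τ_1 + ℓ(τ) - 2. -/
theorem generic_of_bounded {K : Type*} [Field K] {q t : K} (hq : q ≠ 0) (ht : t ≠ 0)
    (hgen : ∀ (a : ℕ) (b : ℤ), a ≠ 0 ∨ b ≠ 0 →
      |b| ≤ (μ.rowLen 0 : ℤ) + (μ.colLen 0 : ℤ) - 2 → q ^ a * t ^ b ≠ 1) : Generic q t μ where
  q_ne_zero := hq
  t_ne_zero := ht
  ne_one a x y hx hy h := by
    have bound : ∀ z : ℕ × ℕ, z ∈ μ → z.1 < μ.colLen 0 ∧ z.2 < μ.rowLen 0 := fun z hz =>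
      ⟨YoungDiagram.mem_iff_lt_colLen.1 (μ.up_left_mem le_rfl (Nat.zero_le z.2) hz),
        YoungDiagram.mem_iff_lt_rowLen.1 (μ.up_left_mem (Nat.zero_le z.1) le_rfl hz)⟩
    have hx' := bound x hx
    have hy' := bound y hy
    refine hgen a _ (h.imp_right sub_ne_zero.2) ?_
    rw [abs_le]
    unfold boxContent
    constructor <;> omega

namespace RSYT

theorem pos_mem (S : RSYT μ n) (k : Fin (n + 1)) : (S.pos k).1 ∈ μ :=
  (YoungDiagram.mem_cells _).1 (S.pos k).2

theorem content_eq (S : RSYT μ n) (k : Fin (n + 1)) : S.content k = boxContent (S.pos k).1 := rfl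

theorem exists_entry (S : RSYT μ n) {x : ℕ × ℕ} (hx : x ∈ μ) : ∃ k, (S.pos k).1 = x :=
  ⟨S.pos.symm ⟨x, (YoungDiagram.mem_cells _).2 hx⟩, by simp⟩

theorem eq_of_pos_eq (S : RSYT μ n) {k l : Fin (n + 1)} (h : (S.pos k).1 = (S.pos l).1) : k = l :=
  S.pos.injective (Subtype.ext h)

/-- Between two entries on a common diagonal there are at least two further entries. -/
theorem exists_between_of_content_eq (S : RSYT μ n) {k l : Fin (n + 1)} (hkl : k ≠ l)
    (h : S.content k = S.content l) :
    ∃ a b, a ≠ b ∧ ((k < a ∧ a < l ∧ k < b ∧ b < l) ∨ (l < a ∧ a < k ∧ l < b ∧ b < k)) := by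
  have key : ∀ k l : Fin (n + 1), S.content k = S.content l → (S.pos k).1.1 < (S.pos l).1.1 →
      ∃ a b, a ≠ b ∧ (l < a ∧ a < k ∧ l < b ∧ b < k) := by
    intro k l h hlt
    have h' : ((S.pos k).1.2 : ℤ) - (S.pos k).1.1 = (S.pos l).1.2 - (S.pos l).1.1 := h
    have hlt2 : (S.pos k).1.2 < (S.pos l).1.2 := by omega
    -- `a` and `b` occupy the two other corners of the rectangle spanned by the boxes of `k` and
    -- `l`.
    obtain ⟨a, ha⟩ := S.exists_entry (μ.up_left_mem hlt.le le_rfl (S.pos_mem l))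
    obtain ⟨b, hb⟩ := S.exists_entry (μ.up_left_mem le_rfl hlt2.le (S.pos_mem l))
    refine ⟨a, b, ?_, S.col_decr _ _ (by simp [ha]) (by simp [ha, hlt]),
      S.row_decr _ _ (by simp [ha]) (by simp [ha, hlt2]),
      S.row_decr _ _ (by simp [hb]) (by simp [hb, hlt2]),
      S.col_decr _ _ (by simp [hb]) (by simp [hb, hlt])⟩
    rintro rfl
    have : (S.pos k).1.1 = (S.pos l).1.1 := (Prod.mk.inj (ha.symm.trans hb)).1
    omega
  rcases lt_trichotomy (S.pos k).1.1 (S.pos l).1.1 with hlt | heq | hlt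
  · obtain ⟨a, b, hab, hc⟩ := key k l h hlt
    exact ⟨a, b, hab, Or.inr hc⟩
  · have h' : ((S.pos k).1.2 : ℤ) - (S.pos k).1.1 = (S.pos l).1.2 - (S.pos l).1.1 := h
    exact absurd (S.eq_of_pos_eq (Prod.ext heq (by omega))) hkl
  · obtain ⟨a, b, hab, hc⟩ := key l k h.symm hlt
    exact ⟨a, b, hab, Or.inl hc⟩

/-- Two further entries do not fit between `k` and `l`. Gap 1 keeps the denominators of `tau`
nonzero; gap 2 is needed for the braid relation. -/
theorem content_ne (S : RSYT μ n) {k l : Fin (n + 1)} (hkl : k < l) (h2 : (l : ℕ) ≤ k + 2) :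
    S.content k ≠ S.content l := by
  intro h
  obtain ⟨a, b, hab, hc⟩ := S.exists_between_of_content_eq hkl.ne h
  rw [Ne, Fin.ext_iff] at hab
  simp only [Fin.lt_def] at hc hkl
  omega

/-- A box between the two would hold an entry strictly between consecutive integers, so the boxes
are neighbours. -/
theorem content_of_row_eq (S : RSYT μ n) (i : Fin n) (h : S.row i.castSucc = S.row i.succ) :
    S.content i.castSucc = S.content i.succ + 1 := by
  have h' : (S.pos i.castSucc).1.1 = (S.pos i.succ).1.1 := h
  have hlt : (S.pos i.succ).1.2 < (S.pos i.castSucc).1.2 := by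
    rcases lt_trichotomy (S.pos i.succ).1.2 (S.pos i.castSucc).1.2 with hl | he | hl
    · exact hl
    · exact absurd (S.eq_of_pos_eq (Prod.ext h' he.symm)) (Fin.castSucc_lt_succ).ne
    · exact absurd (S.row_decr _ _ h' hl) (Fin.castSucc_lt_succ).not_gt
  obtain ⟨a, ha⟩ := S.exists_entry
    (μ.up_left_mem (i2 := (S.pos i.castSucc).1.1) (j1 := (S.pos i.succ).1.2 + 1) le_rfl hlt
      (S.pos_mem i.castSucc))
  have h1 : a < i.succ := S.row_decr _ _ (by simp [ha, h']) (by simp [ha])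
  have h2 : (S.pos i.castSucc).1.2 = (S.pos i.succ).1.2 + 1 := by
    by_contra hne
    have h2 : i.castSucc < a := S.row_decr _ _ (by simp [ha]) (by simp only [ha]; omega)
    simp only [Fin.lt_def, Fin.val_succ, Fin.val_castSucc] at h1 h2
    omega
  simp only [content, row, col, h', h2]
  push_cast
  ring

theorem content_of_col_eq (S : RSYT μ n) (i : Fin n) (h : S.col i.castSucc = S.col i.succ) :
    S.content i.succ = S.content i.castSucc + 1 := by
  have h' : (S.pos i.castSucc).1.2 = (S.pos i.succ).1.2 := h
  have hlt : (S.pos i.succ).1.1 < (S.pos i.castSucc).1.1 := by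
    rcases lt_trichotomy (S.pos i.succ).1.1 (S.pos i.castSucc).1.1 with hl | he | hl
    · exact hl
    · exact absurd (S.eq_of_pos_eq (Prod.ext he.symm h')) (Fin.castSucc_lt_succ).ne
    · exact absurd (S.col_decr _ _ h' hl) (Fin.castSucc_lt_succ).not_gt
  obtain ⟨a, ha⟩ := S.exists_entry
    (μ.up_left_mem (i1 := (S.pos i.succ).1.1 + 1) (j2 := (S.pos i.castSucc).1.2) hlt le_rfl
      (S.pos_mem i.castSucc))
  have h1 : a < i.succ := S.col_decr _ _ (by simp [ha, h']) (by simp [ha])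
  have h2 : (S.pos i.castSucc).1.1 = (S.pos i.succ).1.1 + 1 := by
    by_contra hne
    have h2 : i.castSucc < a := S.col_decr _ _ (by simp [ha]) (by simp only [ha]; omega)
    simp only [Fin.lt_def, Fin.val_succ, Fin.val_castSucc] at h1 h2
    omega
  simp only [content, row, col, h', h2]
  push_cast
  ring

/-- The largest entry occupies the corner box. This starts the descending induction for the
Jucys–Murphy eigenvalues. -/
theorem content_last (S : RSYT μ n) : S.content (Fin.last n) = 0 := by
  have h2 : (S.pos (Fin.last n)).1.2 = 0 := by
    by_contra hne
    obtain ⟨k, hk⟩ := S.exists_entry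
      (μ.up_left_mem le_rfl (Nat.zero_le (S.pos (Fin.last n)).1.2) (S.pos_mem _))
    exact (Fin.le_last k).not_gt
      (S.row_decr k (Fin.last n) (by simp [hk]) (by simp only [hk]; omega))
  have h1 : (S.pos (Fin.last n)).1.1 = 0 := by
    by_contra hne
    obtain ⟨k, hk⟩ := S.exists_entry
      (μ.up_left_mem (Nat.zero_le (S.pos (Fin.last n)).1.1) le_rfl (S.pos_mem _))
    exact (Fin.le_last k).not_gt
      (S.col_decr k (Fin.last n) (by simp [hk]) (by simp only [hk]; omega))
  simp [content, row, col, h1, h2]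

end RSYT

end Tableaux

/-! ### The seminormal representation -/

section Seminormal

variable {K : Type*} [Field K] {μ : YoungDiagram} {n : ℕ}

/-- The diagonal coefficient of `τ(T_i)` for boxes `x`, `y` with entries `i`, `i + 1`. -/
def diagCoeff (t : K) (x y : ℕ × ℕ) : K :=
  (t - 1) * t ^ boxContent x / (t ^ boxContent x - t ^ boxContent y)

/-- The coefficient of the exchanged tableau in `τ(T_i)`, for boxes `x`, `y` with entries
`i`, `i + 1`. -/
def exchCoeff (t : K) (x y : ℕ × ℕ) : K :=
  if x.1 = y.1 ∨ x.2 = y.2 then 0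
  else if x.1 < y.1 then 1
  else (t * t ^ boxContent x - t ^ boxContent y) * (t ^ boxContent x - t * t ^ boxContent y)
    / (t ^ boxContent x - t ^ boxContent y) ^ 2

/-- Fillings of the boxes of `μ`, without any monotonicity. -/
abbrev Filling (μ : YoungDiagram) (n : ℕ) : Type := Fin (n + 1) ≃ {c : ℕ × ℕ // c ∈ μ.cells}

/-- The formulas of the seminormal representation, on arbitrary fillings. -/
noncomputable def fillingOp (t : K) (i : Fin n) : Module.End K (Filling μ n →₀ K) :=
  Finsupp.linearCombination K fun p =>
    diagCoeff t (p i.castSucc).1 (p i.succ).1 • Finsupp.single p 1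
      + exchCoeff t (p i.castSucc).1 (p i.succ).1
        • Finsupp.single ((Equiv.swap i.castSucc i.succ).trans p) 1

theorem fillingOp_single (t : K) (i : Fin n) (p : Filling μ n) :
    fillingOp t i (Finsupp.single p 1) =
      diagCoeff t (p i.castSucc).1 (p i.succ).1 • Finsupp.single p 1
      + exchCoeff t (p i.castSucc).1 (p i.succ).1
        • Finsupp.single ((Equiv.swap i.castSucc i.succ).trans p) 1 := by
  simp [fillingOp]

/-- Tableaux are fillings. -/
noncomputable def toFilling (K : Type*) [Field K] (μ : YoungDiagram) (n : ℕ) :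
    V K μ n →ₗ[K] (Filling μ n →₀ K) :=
  Finsupp.lmapDomain K K RSYT.pos

theorem toFilling_single (S : RSYT μ n) :
    toFilling K μ n (Finsupp.single S 1) = Finsupp.single S.pos 1 := by
  simp [toFilling]

theorem toFilling_injective : Function.Injective (toFilling K μ n) :=
  Finsupp.mapDomain_injective fun _ _ h => RSYT.ext h

theorem tau_single (t : K) (i : Fin n) (S : RSYT μ n) :
    tau t i (Finsupp.single S 1) = tauBasis t i S := by
  simp [tau]

theorem RSYT.zpow_content_ne {q t : K} (hg : Generic q t μ) (S : RSYT μ n)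
    {k l : Fin (n + 1)} (hkl : k < l) (h2 : (l : ℕ) ≤ k + 2) :
    t ^ S.content k ≠ t ^ S.content l :=
  hg.zpow_ne (S.pos_mem k) (S.pos_mem l) (S.content_ne hkl h2)

end Seminormal

/-! ### Coxeter relations of adjacent transpositions. -/

theorem swap_swap_comm {n : ℕ} (i j : Fin n) (hij : (i : ℕ) + 1 < j) (k : Fin (n + 1)) :
    Equiv.swap i.castSucc i.succ (Equiv.swap j.castSucc j.succ k)
      = Equiv.swap j.castSucc j.succ (Equiv.swap i.castSucc i.succ k) := by
  have e1 : i.castSucc ≠ j.castSucc := by simp only [Ne, Fin.ext_iff, Fin.val_castSucc]; omega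
  have e2 : i.castSucc ≠ j.succ := by
    simp only [Ne, Fin.ext_iff, Fin.val_castSucc, Fin.val_succ]; omega
  have e3 : i.succ ≠ j.castSucc := by
    simp only [Ne, Fin.ext_iff, Fin.val_castSucc, Fin.val_succ]; omega
  have e4 : i.succ ≠ j.succ := by simp only [Ne, Fin.ext_iff, Fin.val_succ]; omega
  have hd : Equiv.Perm.Disjoint (Equiv.swap i.castSucc i.succ) (Equiv.swap j.castSucc j.succ) := by
    intro k
    by_cases h1 : k = i.castSucc
    · subst h1; exact Or.inr (Equiv.swap_apply_of_ne_of_ne e1 e2)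
    by_cases h2 : k = i.succ
    · subst h2; exact Or.inr (Equiv.swap_apply_of_ne_of_ne e3 e4)
    · exact Or.inl (Equiv.swap_apply_of_ne_of_ne h1 h2)
  exact DFunLike.congr_fun hd.commute.eq k

theorem swap_swap_braid {n : ℕ} (i j : Fin n) (hij : (i : ℕ) + 1 = j) (k : Fin (n + 1)) :
    Equiv.swap i.castSucc i.succ (Equiv.swap j.castSucc j.succ (Equiv.swap i.castSucc i.succ k))
      = Equiv.swap j.castSucc j.succ
        (Equiv.swap i.castSucc i.succ (Equiv.swap j.castSucc j.succ k)) := by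
  have hj : j.castSucc = i.succ := by simp [Fin.ext_iff, ← hij]
  have n01 : i.castSucc ≠ i.succ := (Fin.castSucc_lt_succ).ne
  have n12 : i.succ ≠ j.succ := by simp only [Ne, Fin.ext_iff, Fin.val_succ]; omega
  have n02 : i.castSucc ≠ j.succ := by
    simp only [Ne, Fin.ext_iff, Fin.val_castSucc, Fin.val_succ]; omega
  have h1 := Equiv.swap_mul_swap_mul_swap n01 n02
  have h2 := Equiv.swap_mul_swap_mul_swap (x := j.succ) (y := i.succ) (z := i.castSucc)
    n12.symm n02.symm
  rw [Equiv.swap_comm j.succ i.succ, Equiv.swap_comm i.succ i.castSucc,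
    Equiv.swap_comm i.castSucc j.succ] at h2
  rw [hj]
  exact DFunLike.congr_fun (h2.trans h1.symm) k

/-! ### Hecke relations in the seminormal representation. -/

section Seminormal

variable {K : Type*} [Field K] {μ : YoungDiagram} {n : ℕ}

theorem diagCoeff_of_row_eq {q t : K} (hg : Generic q t μ) (S : RSYT μ n) (i : Fin n)
    (h : S.row i.castSucc = S.row i.succ) :
    diagCoeff t (S.pos i.castSucc).1 (S.pos i.succ).1 = t := by
  have hne := S.zpow_content_ne hg (Fin.castSucc_lt_succ (i := i)) (by simp)
  have hc := S.content_of_row_eq i h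
  rw [diagCoeff, ← S.content_eq, ← S.content_eq, div_eq_iff (sub_ne_zero.2 hne), hc,
    zpow_add_one₀ hg.t_ne_zero]
  ring

theorem diagCoeff_of_col_eq {q t : K} (hg : Generic q t μ) (S : RSYT μ n) (i : Fin n)
    (h : S.col i.castSucc = S.col i.succ) :
    diagCoeff t (S.pos i.castSucc).1 (S.pos i.succ).1 = -1 := by
  have hne := S.zpow_content_ne hg (Fin.castSucc_lt_succ (i := i)) (by simp)
  have hc := S.content_of_col_eq i h
  rw [diagCoeff, ← S.content_eq, ← S.content_eq, div_eq_iff (sub_ne_zero.2 hne), hc,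
    zpow_add_one₀ hg.t_ne_zero]
  ring

/-- The trace of T_i on the span of a tableau and its exchange is t - 1. -/
theorem diagCoeff_add_swap {t : K} {x y : ℕ × ℕ} (h : t ^ boxContent x ≠ t ^ boxContent y) :
    diagCoeff t y x = t - 1 - diagCoeff t x y := by
  have h1 := sub_ne_zero.2 h
  have h2 := sub_ne_zero.2 h.symm
  unfold diagCoeff
  field_simp
  ring

theorem exchCoeff_of_lt {t : K} {x y : ℕ × ℕ} (hr : x.1 < y.1) (hc : x.2 ≠ y.2) :
    exchCoeff t x y = 1 := by
  rw [exchCoeff, if_neg (not_or.2 ⟨hr.ne, hc⟩), if_pos hr]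

theorem exchCoeff_of_not_lt {t : K} {x y : ℕ × ℕ} (hr : x.1 ≠ y.1) (hc : x.2 ≠ y.2)
    (hlt : ¬ x.1 < y.1) :
    exchCoeff t x y =
      (t * t ^ boxContent x - t ^ boxContent y) * (t ^ boxContent x - t * t ^ boxContent y)
        / (t ^ boxContent x - t ^ boxContent y) ^ 2 := by
  rw [exchCoeff, if_neg (not_or.2 ⟨hr, hc⟩), if_neg hlt]

/-- Together with the trace, this says that the 2×2 block of T_i has determinant -t, hence
eigenvalues t and -1. In a common row or column both sides vanish. -/
theorem exchCoeff_mul_swap {t : K} {x y : ℕ × ℕ} (h : t ^ boxContent x ≠ t ^ boxContent y)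
    (h1 : x.1 = y.1 → diagCoeff t x y = t) (h2 : x.2 = y.2 → diagCoeff t x y = -1) :
    exchCoeff t x y * exchCoeff t y x = (t - diagCoeff t x y) * (1 + diagCoeff t x y) := by
  by_cases hr : x.1 = y.1
  · simp [exchCoeff, hr, h1 hr]
  by_cases hc : x.2 = y.2
  · simp [exchCoeff, hc, h2 hc]
  have e1 := sub_ne_zero.2 h
  have e2 := sub_ne_zero.2 h.symm
  rcases lt_or_gt_of_ne hr with hl | hl
  · rw [exchCoeff_of_lt hl hc, exchCoeff_of_not_lt (Ne.symm hr) (Ne.symm hc) hl.not_gt, diagCoeff]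
    field_simp
    ring
  · rw [exchCoeff_of_lt hl (Ne.symm hc), exchCoeff_of_not_lt hr hc hl.not_gt, diagCoeff]
    field_simp
    ring

/-- The exchange coefficients at neighbouring entries of a tableau. -/
theorem RSYT.exchCoeff_mul {q t : K} (hg : Generic q t μ) (S : RSYT μ n) (i : Fin n) :
    exchCoeff t (S.pos i.castSucc).1 (S.pos i.succ).1
        * exchCoeff t (S.pos i.succ).1 (S.pos i.castSucc).1
      = (t - diagCoeff t (S.pos i.castSucc).1 (S.pos i.succ).1)
        * (1 + diagCoeff t (S.pos i.castSucc).1 (S.pos i.succ).1) :=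
  exchCoeff_mul_swap (S.zpow_content_ne hg (Fin.castSucc_lt_succ (i := i)) (by simp))
    (diagCoeff_of_row_eq hg S i) (diagCoeff_of_col_eq hg S i)

/-- Either the exchanged filling does not contribute, or it is a tableau. -/
theorem RSYT.exchange_cases (t : K) (S : RSYT μ n) (i : Fin n) :
    exchCoeff t (S.pos i.castSucc).1 (S.pos i.succ).1 = 0 ∨
      ∃ S' : RSYT μ n, S'.pos = (Equiv.swap i.castSucc i.succ).trans S.pos := by
  by_cases hr : S.row i.castSucc = S.row i.succ
  · exact Or.inl (if_pos (Or.inl hr))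
  by_cases hc : S.col i.castSucc = S.col i.succ
  · exact Or.inl (if_pos (Or.inr hc))
  · exact Or.inr ⟨S.exchange i hr hc, rfl⟩

/-- On fillings the exchange always exists, so the four cases of `tauBasis` merge into one formula
whose exchange coefficient vanishes when `i`, `i + 1` share a row or column. Relations are checked
there, starting from a tableau so that the contents involved are distinct. -/
theorem toFilling_tauBasis {q t : K} (hg : Generic q t μ) (i : Fin n) (S : RSYT μ n) :
    toFilling K μ n (tauBasis t i S) = fillingOp t i (Finsupp.single S.pos 1) := by
  rw [fillingOp_single]
  have hne := S.zpow_content_ne hg (Fin.castSucc_lt_succ (i := i)) (by simp)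
  unfold tauBasis
  split_ifs with hr hc hlt
  · have : exchCoeff t (S.pos i.castSucc).1 (S.pos i.succ).1 = 0 := if_pos (Or.inl hr)
    rw [this, diagCoeff_of_row_eq hg S i hr, map_smul, toFilling_single, zero_smul, add_zero]
  · have : exchCoeff t (S.pos i.castSucc).1 (S.pos i.succ).1 = 0 := if_pos (Or.inr hc)
    rw [this, diagCoeff_of_col_eq hg S i hc, map_neg, toFilling_single, zero_smul, add_zero,
      neg_one_smul]
  · have h1 : exchCoeff t (S.pos i.castSucc).1 (S.pos i.succ).1 = 1 := exchCoeff_of_lt hlt hc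
    have h2 : diagCoeff t (S.pos i.castSucc).1 (S.pos i.succ).1
        = (t - 1) / (1 - t ^ (S.content i.succ - S.content i.castSucc)) := by
      have hA := zpow_ne_zero (S.content i.castSucc) hg.t_ne_zero
      have h0 := sub_ne_zero.2 hne
      rw [diagCoeff, ← S.content_eq, ← S.content_eq, zpow_sub₀ hg.t_ne_zero]
      field_simp
    rw [h1, h2, map_add, map_smul, toFilling_single, toFilling_single, one_smul, add_comm]
    rfl
  · have hB := zpow_ne_zero (S.content i.succ) hg.t_ne_zero
    have h0 := sub_ne_zero.2 hne
    have ht := hg.t_ne_zero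
    have h1 : exchCoeff t (S.pos i.castSucc).1 (S.pos i.succ).1
        = t * (t ^ (S.content i.castSucc - S.content i.succ + 1) - 1)
        * (t ^ (S.content i.castSucc - S.content i.succ - 1) - 1)
        / (t ^ (S.content i.castSucc - S.content i.succ) - 1) ^ 2 := by
      rw [exchCoeff_of_not_lt hr hc hlt, ← S.content_eq, ← S.content_eq,
        zpow_add_one₀ ht, zpow_sub_one₀ ht, zpow_sub₀ ht]
      field_simp
    have h2 : diagCoeff t (S.pos i.castSucc).1 (S.pos i.succ).1
        = t ^ (S.content i.castSucc - S.content i.succ) * (t - 1)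
        / (t ^ (S.content i.castSucc - S.content i.succ) - 1) := by
      rw [diagCoeff, ← S.content_eq, ← S.content_eq, zpow_sub₀ ht]
      field_simp
    rw [← h1, ← h2, map_add, map_smul, map_smul, toFilling_single, toFilling_single, add_comm]
    rfl

theorem toFilling_tau {q t : K} (hg : Generic q t μ) (i : Fin n) (v : V K μ n) :
    toFilling K μ n (tau t i v) = fillingOp t i (toFilling K μ n v) := by
  have : toFilling K μ n ∘ₗ tau t i = fillingOp t i ∘ₗ toFilling K μ n := by
    refine Finsupp.lhom_ext' fun S => LinearMap.ext_ring ?_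
    simp only [LinearMap.comp_apply, Finsupp.lsingle_apply]
    rw [tau_single, toFilling_tauBasis hg, toFilling_single]
  exact LinearMap.congr_fun this v

/-- Identities between the operators `τ(T_i)` may be checked on fillings. -/
theorem tau_ext {f g : Module.End K (V K μ n)}
    (h : ∀ S, toFilling K μ n (f (Finsupp.single S 1)) = toFilling K μ n (g (Finsupp.single S 1))) :
    f = g :=
  Finsupp.lhom_ext' fun S => LinearMap.ext_ring (toFilling_injective (h S))

theorem tau_quad {q t : K} (hg : Generic q t μ) (i : Fin n) :
    (tau t i : Module.End K (V K μ n)) * tau t i = (t - 1) • tau t i + t • 1 := by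
  refine tau_ext fun S => ?_
  have hne := S.zpow_content_ne hg (Fin.castSucc_lt_succ (i := i)) (by simp)
  have hm := S.exchCoeff_mul hg i
  have ha := diagCoeff_add_swap (x := (S.pos i.castSucc).1) (y := (S.pos i.succ).1) hne
  have hs : (Equiv.swap i.castSucc i.succ).trans ((Equiv.swap i.castSucc i.succ).trans S.pos)
      = S.pos := by ext k : 1; simp
  simp only [Module.End.mul_apply, LinearMap.add_apply, LinearMap.smul_apply, Module.End.one_apply,
    map_add, map_smul, toFilling_tau hg, toFilling_single, fillingOp_single,
    Equiv.trans_apply, Equiv.swap_apply_left, Equiv.swap_apply_right, hs, ha]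
  match_scalars
  · linear_combination hm
  · ring

theorem tau_comm {q t : K} (hg : Generic q t μ) (i j : Fin n) (hij : (i : ℕ) + 1 < j) :
    (tau t i : Module.End K (V K μ n)) * tau t j = tau t j * tau t i := by
  refine tau_ext fun S => ?_
  have e1 : i.castSucc ≠ j.castSucc := by simp only [Ne, Fin.ext_iff, Fin.val_castSucc]; omega
  have e2 : i.castSucc ≠ j.succ := by
    simp only [Ne, Fin.ext_iff, Fin.val_castSucc, Fin.val_succ]; omega
  have e3 : i.succ ≠ j.castSucc := by
    simp only [Ne, Fin.ext_iff, Fin.val_castSucc, Fin.val_succ]; omega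
  have e4 : i.succ ≠ j.succ := by simp only [Ne, Fin.ext_iff, Fin.val_succ]; omega
  have hs : (Equiv.swap i.castSucc i.succ).trans ((Equiv.swap j.castSucc j.succ).trans S.pos)
      = (Equiv.swap j.castSucc j.succ).trans ((Equiv.swap i.castSucc i.succ).trans S.pos) := by
    ext k : 1
    exact congrArg S.pos (swap_swap_comm i j hij k).symm
  simp only [Module.End.mul_apply, map_add, map_smul, toFilling_tau hg, toFilling_single, fillingOp_single,
    Equiv.trans_apply, Equiv.swap_apply_of_ne_of_ne e1 e2, Equiv.swap_apply_of_ne_of_ne e3 e4,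
    Equiv.swap_apply_of_ne_of_ne e1.symm e3.symm, Equiv.swap_apply_of_ne_of_ne e2.symm e4.symm, hs]
  module

/-- The scalar identity to which the braid relation reduces. -/
theorem diagCoeff_cocycle {t : K} {x y z : ℕ × ℕ} (hxy : t ^ boxContent x ≠ t ^ boxContent y)
    (hyz : t ^ boxContent y ≠ t ^ boxContent z) (hxz : t ^ boxContent x ≠ t ^ boxContent z) :
    diagCoeff t x y * diagCoeff t y z
      = diagCoeff t x z * (diagCoeff t x y + diagCoeff t y z - (t - 1)) := by
  have h1 := sub_ne_zero.2 hxy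
  have h2 := sub_ne_zero.2 hyz
  have h3 := sub_ne_zero.2 hxz
  unfold diagCoeff
  field_simp
  ring

theorem tau_braid {q t : K} (hg : Generic q t μ) (i j : Fin n) (hij : (i : ℕ) + 1 = j) :
    (tau t i : Module.End K (V K μ n)) * tau t j * tau t i = tau t j * tau t i * tau t j := by
  refine tau_ext fun S => ?_
  have hj : j.castSucc = i.succ := by simp [Fin.ext_iff, ← hij]
  have n01 : i.castSucc ≠ i.succ := (Fin.castSucc_lt_succ).ne
  have n12 : i.succ ≠ j.succ := by simp only [Ne, Fin.ext_iff, Fin.val_succ]; omega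
  have n02 : i.castSucc ≠ j.succ := by
    simp only [Ne, Fin.ext_iff, Fin.val_castSucc, Fin.val_succ]; omega
  have h01 := S.zpow_content_ne hg (Fin.castSucc_lt_succ (i := i)) (by simp)
  have h12 := S.zpow_content_ne hg (Fin.castSucc_lt_succ (i := j)) (by simp)
  have h02 := S.zpow_content_ne hg (k := i.castSucc) (l := j.succ)
    (by simp only [Fin.lt_def, Fin.val_castSucc, Fin.val_succ]; omega)
    (by simp only [Fin.val_castSucc, Fin.val_succ]; omega)
  have hm1 := S.exchCoeff_mul hg i
  have hm2 := S.exchCoeff_mul hg j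
  simp only [hj] at h12 hm2
  have ha1 := diagCoeff_add_swap (x := (S.pos i.castSucc).1) (y := (S.pos i.succ).1) h01
  have ha2 := diagCoeff_add_swap (x := (S.pos i.succ).1) (y := (S.pos j.succ).1) h12
  have hc := diagCoeff_cocycle (x := (S.pos i.castSucc).1) (y := (S.pos i.succ).1)
    (z := (S.pos j.succ).1) h01 h12 h02
  have hs1 : (Equiv.swap i.castSucc i.succ).trans ((Equiv.swap i.castSucc i.succ).trans S.pos)
      = S.pos := by ext k : 1; simp
  have hs2 : (Equiv.swap i.succ j.succ).trans ((Equiv.swap i.succ j.succ).trans S.pos)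
      = S.pos := by ext k : 1; simp
  have hs : (Equiv.swap i.castSucc i.succ).trans
        ((Equiv.swap i.succ j.succ).trans ((Equiv.swap i.castSucc i.succ).trans S.pos))
      = (Equiv.swap i.succ j.succ).trans
        ((Equiv.swap i.castSucc i.succ).trans ((Equiv.swap i.succ j.succ).trans S.pos)) := by
    ext k : 1
    have := swap_swap_braid i j hij k
    rw [hj] at this
    exact congrArg S.pos this
  simp only [Module.End.mul_apply, map_add, map_smul, toFilling_tau hg, toFilling_single, fillingOp_single,
    Equiv.trans_apply, Equiv.swap_apply_left, Equiv.swap_apply_right, hj, Equiv.swap_apply_of_ne_of_ne n01 n02,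
    Equiv.swap_apply_of_ne_of_ne n02.symm n12.symm, hs1, hs2, hs, ha1, ha2]
  generalize diagCoeff t (S.pos i.castSucc).1 (S.pos i.succ).1 = a at *
  generalize diagCoeff t (S.pos i.succ).1 (S.pos j.succ).1 = b at *
  generalize diagCoeff t (S.pos i.castSucc).1 (S.pos j.succ).1 = c at *
  generalize exchCoeff t (S.pos i.castSucc).1 (S.pos i.succ).1 = f at *
  generalize exchCoeff t (S.pos i.succ).1 (S.pos j.succ).1 = g at *
  generalize exchCoeff t (S.pos i.castSucc).1 (S.pos j.succ).1 = h at *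
  -- One equation for each arrangement of the three boxes. That of `S` needs the cocycle and both
  -- exchange products, those of its two neighbours only the cocycle; the other three are polynomial
  -- identities.
  match_scalars
  all_goals first
    | ring1
    | linear_combination c * (hm1 - hm2) + (a - b) * hc
    | linear_combination f * hc
    | linear_combination -g * hc

theorem tau_isHecke {q t : K} (hg : Generic q t μ) :
    IsHecke t (tau t : Fin n → Module.End K (V K μ n)) where
  quad := tau_quad hg
  braid := tau_braid hg
  comm := tau_comm hg

end Seminormal

/-! ### Hecke and affine Hecke algebras, and the Cherednik elements. -/

section Hecke

variable {K A : Type*} [Field K] [Ring A] [Algebra K A]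

/-- The product `T_1 T_2 ⋯ T_{N-1}` with the leftmost factor acting first. -/
def heckeW {n : ℕ} (T : Fin n → A) : A := ((List.finRange n).map T).reverse.prod

/-- The product in the opposite order. -/
def heckeD {n : ℕ} (T : Fin n → A) : A := ((List.finRange n).map T).prod

theorem heckeW_succ_last {n : ℕ} (T : Fin (n + 1) → A) :
    heckeW T = T (Fin.last n) * heckeW fun i => T i.castSucc := by
  simp [heckeW, List.finRange_succ_last, Function.comp_def]

theorem heckeW_succ {n : ℕ} (T : Fin (n + 1) → A) :
    heckeW T = (heckeW fun i => T i.succ) * T 0 := by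
  simp [heckeW, List.finRange_succ, Function.comp_def]

theorem heckeD_succ_last {n : ℕ} (T : Fin (n + 1) → A) :
    heckeD T = (heckeD fun i => T i.castSucc) * T (Fin.last n) := by
  simp [heckeD, List.finRange_succ_last, Function.comp_def]

theorem heckeD_succ {n : ℕ} (T : Fin (n + 1) → A) :
    heckeD T = T 0 * heckeD fun i => T i.succ := by
  simp [heckeD, List.finRange_succ, Function.comp_def]

theorem heckeW_intertwine {n : ℕ} (f g : Fin n → A) (x : A) (h : ∀ i, f i * x = x * g i) :
    heckeW f * x = x * heckeW g := by
  induction n with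
  | zero => simp [heckeW]
  | succ n ih =>
    rw [heckeW_succ, heckeW_succ, mul_assoc, h, ← mul_assoc, ih _ _ fun i => h i.succ, mul_assoc]

theorem heckeD_intertwine {n : ℕ} (f g : Fin n → A) (x : A) (h : ∀ i, f i * x = x * g i) :
    heckeD f * x = x * heckeD g := by
  induction n with
  | zero => simp [heckeD]
  | succ n ih =>
    rw [heckeD_succ, heckeD_succ, mul_assoc, ih _ _ fun i => h i.succ, ← mul_assoc, h, mul_assoc]

theorem heckeW_mul_heckeD {n : ℕ} (f g : Fin n → A) (h : ∀ i, f i * g i = 1) :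
    heckeW f * heckeD g = 1 := by
  induction n with
  | zero => simp [heckeW, heckeD]
  | succ n ih =>
    rw [heckeW_succ, heckeD_succ, mul_assoc, ← mul_assoc (f 0), h, one_mul,
      ih _ _ fun i => h i.succ]

theorem heckeD_mul_heckeW {n : ℕ} (f g : Fin n → A) (h : ∀ i, f i * g i = 1) :
    heckeD f * heckeW g = 1 := by
  induction n with
  | zero => simp [heckeW, heckeD]
  | succ n ih =>
    rw [heckeD_succ_last, heckeW_succ_last, mul_assoc, ← mul_assoc (f _), h, one_mul,
      ih _ _ fun i => h i.castSucc]

/-- The inverse of `T_i` in the Hecke algebra. -/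
def heckeInv {n : ℕ} (t : K) (T : Fin n → A) (i : Fin n) : A := t⁻¹ • (T i + (1 - t) • (1 : A))

/-- The elements `ξ_i` obtained from `ξ_N = x` by `ξ_i = t⁻¹ T_i ξ_{i+1} T_i`. -/
def heckeXi {n : ℕ} (t : K) (T : Fin n → A) (x : A) : Fin (n + 1) → A :=
  Fin.reverseInduction x fun i y => t⁻¹ • (T i * y * T i)

theorem heckeXi_last {n : ℕ} (t : K) (T : Fin n → A) (x : A) :
    heckeXi t T x (Fin.last n) = x := by simp [heckeXi]

theorem heckeXi_castSucc {n : ℕ} (t : K) (T : Fin n → A) (x : A) (i : Fin n) :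
    heckeXi t T x i.castSucc = t⁻¹ • (T i * heckeXi t T x i.succ * T i) := by
  simp [heckeXi]

namespace IsHecke

theorem mul_inv {n : ℕ} {t : K} {T : Fin n → A} (h : IsHecke t T) (ht : t ≠ 0) (i : Fin n) :
    T i * heckeInv t T i = 1 := by
  rw [heckeInv, mul_smul_comm, mul_add, h.quad, mul_smul_comm, mul_one]
  have : (t - 1) • T i + t • (1 : A) + (1 - t) • T i = t • (1 : A) := by module
  rw [this, smul_smul, inv_mul_cancel₀ ht, one_smul]

theorem inv_mul {n : ℕ} {t : K} {T : Fin n → A} (h : IsHecke t T) (ht : t ≠ 0) (i : Fin n) :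
    heckeInv t T i * T i = 1 := by
  rw [heckeInv, smul_mul_assoc, add_mul, h.quad, smul_mul_assoc, one_mul]
  have : (t - 1) • T i + t • (1 : A) + (1 - t) • T i = t • (1 : A) := by module
  rw [this, smul_smul, inv_mul_cancel₀ ht, one_smul]

theorem castSucc {n : ℕ} {t : K} {T : Fin (n + 1) → A} (h : IsHecke t T) :
    IsHecke t fun i : Fin n => T i.castSucc where
  quad i := h.quad _
  braid i j hij := h.braid _ _ (by simpa using hij)
  comm i j hij := h.comm _ _ (by simpa using hij)

/-- Conjugation by ω shifts the generators: T_i commutes with all factors except those near its own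
index, where one braid relation turns it into T_{i+1}. -/
theorem mul_heckeW {n : ℕ} {t : K} {T : Fin n → A} (h : IsHecke t T) (i j : Fin n)
    (hij : (i : ℕ) + 1 = j) : T i * heckeW T = heckeW T * T j := by
  induction n with
  | zero => exact i.elim0
  | succ n ih =>
    rw [heckeW_succ_last]
    obtain ⟨i, rfl⟩ : ∃ i' : Fin n, i = i'.castSucc :=
      ⟨⟨i, by omega⟩, by simp⟩
    induction j using Fin.lastCases with
    | cast j =>
      rw [mul_assoc, ← ih h.castSucc i j (by simpa using hij), ← mul_assoc, ← mul_assoc,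
        h.comm i.castSucc (Fin.last n) (by simp at hij ⊢; omega)]
    | last =>
      cases n with
      | zero => exact i.elim0
      | succ n =>
        have hi : i = Fin.last n := by simp [Fin.ext_iff] at hij ⊢; omega
        subst hi
        have hc : heckeW (fun k : Fin n => T k.castSucc.castSucc) * T (Fin.last (n + 1))
            = T (Fin.last (n + 1)) * heckeW (fun k : Fin n => T k.castSucc.castSucc) :=
          heckeW_intertwine _ _ _ fun k => h.comm _ _ (by simp)
        rw [heckeW_succ_last, mul_assoc, mul_assoc, hc]
        have hb := h.braid (Fin.last n).castSucc (Fin.last (n + 1)) (by simp)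
        simp only [← mul_assoc]
        rw [hb]

/-- The wrap-around case of the shift. If W' is W without its factor T_{N-1}, shifting gives W² = W'
W T_1, and multiplying by T_{N-1} on the left restores W W T_1. -/
theorem last_mul_heckeW_sq {n : ℕ} {t : K} {T : Fin n → A} (h : IsHecke t T) (i j : Fin n)
    (hi : (i : ℕ) = 0) (hj : (j : ℕ) + 1 = n) :
    T j * (heckeW T * heckeW T) = heckeW T * heckeW T * T i := by
  cases n with
  | zero => exact i.elim0
  | succ n =>
    obtain rfl : i = 0 := Fin.ext hi
    obtain rfl : j = Fin.last n := Fin.ext (by simpa using hj)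
    have h1 : heckeW (fun k : Fin n => T k.castSucc) * heckeW T
        = heckeW T * heckeW (fun k : Fin n => T k.succ) :=
      heckeW_intertwine _ _ _ fun k => h.mul_heckeW _ _ (by simp)
    have h2 : heckeW T * heckeW T = heckeW (fun k : Fin n => T k.castSucc) * heckeW T * T 0 := by
      rw [h1, mul_assoc, ← heckeW_succ]
    calc T (Fin.last n) * (heckeW T * heckeW T)
        = T (Fin.last n) * heckeW (fun k : Fin n => T k.castSucc) * heckeW T * T 0 := by
          rw [h2]; simp only [mul_assoc]
      _ = _ := by rw [← heckeW_succ_last]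

theorem comm_xi_of_lt {n : ℕ} {t : K} {T : Fin n → A} (h : IsHecke t T) {x : A}
    (hx : ∀ i j : Fin n, (i : ℕ) + 1 = j → T i * x = x * T i) (k : Fin (n + 1)) :
    ∀ i : Fin n, (i : ℕ) + 1 < k → T i * heckeXi t T x k = heckeXi t T x k * T i := by
  induction k using Fin.reverseInduction with
  | last =>
    intro i hi
    rw [heckeXi_last]
    exact hx i ⟨i + 1, by simpa using hi⟩ rfl
  | cast k ih =>
    intro i hi
    rw [Fin.val_castSucc] at hi
    have h1 := ih i (by simp; omega)
    have h2 := h.comm i k hi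
    rw [heckeXi_castSucc, mul_smul_comm, smul_mul_assoc]
    congr 1
    calc T i * (T k * heckeXi t T x k.succ * T k)
        = T i * T k * heckeXi t T x k.succ * T k := by simp only [mul_assoc]
      _ = T k * (T i * heckeXi t T x k.succ) * T k := by rw [h2]; simp only [mul_assoc]
      _ = T k * heckeXi t T x k.succ * (T i * T k) := by rw [h1]; simp only [mul_assoc]
      _ = _ := by rw [h2]; simp only [mul_assoc]

/-- The new case is i = k + 1: the braid relation moves T_i through the outer factors as T_k, which
commutes with the inner ξ_{k+2}. -/
theorem comm_xi_of_gt {n : ℕ} {t : K} {T : Fin n → A} (h : IsHecke t T) {x : A}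
    (hx : ∀ i j : Fin n, (i : ℕ) + 1 = j → T i * x = x * T i) (k : Fin (n + 1)) :
    ∀ i : Fin n, (k : ℕ) < i → T i * heckeXi t T x k = heckeXi t T x k * T i := by
  induction k using Fin.reverseInduction with
  | last =>
    intro i hi
    simp only [Fin.val_last] at hi
    omega
  | cast k ih =>
    intro i hi
    rw [Fin.val_castSucc] at hi
    rcases Nat.lt_or_ge (k + 1) i with hlt | hge
    · have h1 := ih i (by simpa using hlt)
      have h2 := (h.comm k i hlt).symm
      rw [heckeXi_castSucc, mul_smul_comm, smul_mul_assoc]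
      congr 1
      calc T i * (T k * heckeXi t T x k.succ * T k)
          = T i * T k * heckeXi t T x k.succ * T k := by simp only [mul_assoc]
        _ = T k * (T i * heckeXi t T x k.succ) * T k := by rw [h2]; simp only [mul_assoc]
        _ = T k * heckeXi t T x k.succ * (T i * T k) := by rw [h1]; simp only [mul_assoc]
        _ = _ := by rw [h2]; simp only [mul_assoc]
    · have hki : k.succ = i.castSucc := by simp [Fin.ext_iff]; omega
      have hb := h.braid k i (by omega)
      have h1 := h.comm_xi_of_lt hx i.succ k (by simp; omega)
      rw [heckeXi_castSucc, hki, heckeXi_castSucc]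
      simp only [mul_smul_comm, smul_mul_assoc]
      congr 2
      generalize heckeXi t T x i.succ = y at *
      calc T i * (T k * (T i * y * T i) * T k)
          = (T i * T k * T i) * y * T i * T k := by simp only [mul_assoc]
        _ = T k * T i * (T k * y) * T i * T k := by rw [← hb]; simp only [mul_assoc]
        _ = T k * T i * y * (T k * T i * T k) := by rw [h1]; simp only [mul_assoc]
        _ = _ := by rw [hb]; simp only [mul_assoc]

end IsHecke

/-- The relations between the operators `T_i`, the multiplications by `x_i` and `w`. -/
structure IsAffineHecke {n : ℕ} (q t : K) (T : Fin n → A) (X : Fin (n + 1) → A) (w : A) : Prop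
    extends IsHecke t T where
  X_castSucc : ∀ i, T i * X i.castSucc = X i.succ * (T i + (1 - t) • (1 : A))
  X_comm : ∀ i k, k ≠ i.castSucc → k ≠ i.succ → T i * X k = X k * T i
  w_X_succ : ∀ i : Fin n, w * X i.succ = X i.castSucc * w
  w_X_zero : w * X 0 = q • (X (Fin.last n) * w)
  w_T : ∀ i j : Fin n, (i : ℕ) + 1 = j → T i * w = w * T j
  w_sq_T : ∀ i j : Fin n, (i : ℕ) = 0 → (j : ℕ) + 1 = n → T j * (w * w) = w * w * T i

theorem heckeInv_intertwine {n : ℕ} {t : K} {T : Fin n → A} {i j : Fin n} {x : A}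
    (h : T i * x = x * T j) : heckeInv t T i * x = x * heckeInv t T j := by
  simp only [heckeInv, smul_mul_assoc, mul_smul_comm, add_mul, mul_add, h, one_mul, mul_one]

namespace IsAffineHecke

variable {n : ℕ} {q t : K} {T : Fin n → A} {X : Fin (n + 1) → A} {w : A}

/-- The Cherednik operators. -/
def xi (t : K) (T : Fin n → A) (w : A) : Fin (n + 1) → A :=
  heckeXi t T (w * heckeD (heckeInv t T))

/-- The relation `X_castSucc` in its symmetric form x_i = t T_i⁻¹ x_{i+1} T_i⁻¹. -/
theorem inv_X_succ (h : IsAffineHecke q t T X w) (ht : t ≠ 0) (i : Fin n) :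
    heckeInv t T i * X i.succ = t⁻¹ • (X i.castSucc * T i) := by
  have h1 := h.X_castSucc i
  have h2 : X i.castSucc = t • (heckeInv t T i * (X i.succ * heckeInv t T i)) := by
    calc X i.castSucc = heckeInv t T i * (T i * X i.castSucc) := by
          rw [← mul_assoc, h.inv_mul ht, one_mul]
      _ = _ := by
          rw [h1, heckeInv, ← mul_smul_comm, ← mul_smul_comm, smul_smul, mul_inv_cancel₀ ht,
            one_smul]
  rw [h2, smul_mul_assoc, smul_smul, inv_mul_cancel₀ ht, one_smul, mul_assoc, mul_assoc,
    h.inv_mul ht, mul_one]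

theorem T_X_castSucc (h : IsAffineHecke q t T X w) (i : Fin n) :
    t⁻¹ • (T i * X i.castSucc) = X i.succ * heckeInv t T i := by
  rw [h.X_castSucc, heckeInv, mul_smul_comm]

/-- ξ_N is w times the inverse of `heckeW T`. Both w and `heckeW T` shift T_i to T_{i+1}, so the
shifts cancel. -/
theorem T_xiLast (h : IsAffineHecke q t T X w) (ht : t ≠ 0) (i j : Fin n)
    (hij : (i : ℕ) + 1 = j) :
    T i * (w * heckeD (heckeInv t T)) = w * heckeD (heckeInv t T) * T i := by
  have h1 : heckeD (heckeInv t T) * T i = T j * heckeD (heckeInv t T) := by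
    have e := h.mul_heckeW i j hij
    have e1 := heckeW_mul_heckeD T (heckeInv t T) (h.mul_inv ht)
    have e2 := heckeD_mul_heckeW (heckeInv t T) T (h.inv_mul ht)
    calc heckeD (heckeInv t T) * T i
        = heckeD (heckeInv t T) * (T i * heckeW T) * heckeD (heckeInv t T) := by
          simp only [mul_assoc]; rw [e1, mul_one]
      _ = _ := by rw [e, ← mul_assoc, e2, one_mul]
  rw [← mul_assoc, h.w_T i j hij, mul_assoc, mul_assoc, h1]

theorem T_xi (h : IsAffineHecke q t T X w) (ht : t ≠ 0) (i : Fin n) (k : Fin (n + 1))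
    (h1 : k ≠ i.castSucc) (h2 : k ≠ i.succ) : T i * xi t T w k = xi t T w k * T i := by
  simp only [Ne, Fin.ext_iff, Fin.val_castSucc, Fin.val_succ] at h1 h2
  rcases Nat.lt_or_ge k i with hlt | hge
  · exact h.comm_xi_of_gt (h.T_xiLast ht) k i hlt
  · exact h.comm_xi_of_lt (h.T_xiLast ht) k i (by omega)

/-- Each factor lowers the index of x by one at the cost of t⁻¹. The families are arbitrary so that
the induction can drop the last index. -/
theorem heckeD_X_last {n : ℕ} {t : K} {T T' : Fin n → A} {X : Fin (n + 1) → A}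
    (h : ∀ i, T' i * X i.succ = t⁻¹ • (X i.castSucc * T i)) :
    heckeD T' * X (Fin.last n) = (t⁻¹) ^ n • (X 0 * heckeD T) := by
  induction n with
  | zero => simp [heckeD]
  | succ n ih =>
    have := ih (T := fun i => T i.castSucc) (T' := fun i => T' i.castSucc)
      (X := fun i => X i.castSucc) fun i => h i.castSucc
    rw [heckeD_succ_last, mul_assoc, ← Fin.succ_last, h, mul_smul_comm, ← mul_assoc, this,
      smul_mul_assoc, smul_smul, heckeD_succ_last, mul_assoc, pow_succ', Fin.castSucc_zero]

theorem heckeXi_zero {n : ℕ} (t : K) (T : Fin n → A) (x : A) :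
    heckeXi t T x 0 = (t⁻¹) ^ n • (heckeD T * x * heckeW T) := by
  induction n with
  | zero =>
    have := heckeXi_last t T x
    rw [Fin.last_zero] at this
    simp [heckeD, heckeW, this]
  | succ n ih =>
    have key : ∀ k : Fin (n + 1), heckeXi t (fun i => T i.succ) x k = heckeXi t T x k.succ := by
      intro k
      induction k using Fin.reverseInduction with
      | last => rw [heckeXi_last, Fin.succ_last, heckeXi_last]
      | cast k ih' => rw [heckeXi_castSucc, ih', ← Fin.castSucc_succ, heckeXi_castSucc]
    have h0 : heckeXi t T x 0 = t⁻¹ • (T 0 * heckeXi t T x (Fin.succ 0) * T 0) := by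
      rw [← heckeXi_castSucc, Fin.castSucc_zero]
    rw [h0, ← key, ih, heckeD_succ, heckeW_succ, mul_smul_comm, smul_mul_assoc, smul_smul,
      pow_succ']
    simp only [mul_assoc]

/-- Unrolling the recursion down to the first index brings in all of `heckeW T`, which cancels the
inverses in ξ_N. This inverse-free form is what the affine norm uses. -/
theorem xi_zero (h : IsAffineHecke q t T X w) (ht : t ≠ 0) :
    xi t T w 0 = (t⁻¹) ^ n • (heckeD T * w) := by
  rw [xi, heckeXi_zero]
  have e2 := heckeD_mul_heckeW (heckeInv t T) T (h.inv_mul ht)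
  rw [mul_assoc, mul_assoc, e2, mul_one]

/-- The affine step. -/
theorem xi_last_affine (h : IsAffineHecke q t T X w) (ht : t ≠ 0) :
    xi t T w (Fin.last n) * (X (Fin.last n) * w) = q • (X (Fin.last n) * w * xi t T w 0) := by
  rw [h.xi_zero ht, xi, heckeXi_last]
  calc w * heckeD (heckeInv t T) * (X (Fin.last n) * w)
      = w * (heckeD (heckeInv t T) * X (Fin.last n)) * w := by simp only [mul_assoc]
    _ = (t⁻¹) ^ n • ((w * X 0) * heckeD T * w) := by
        rw [heckeD_X_last (h.inv_X_succ ht)]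
        simp only [mul_smul_comm, smul_mul_assoc, mul_assoc]
    _ = _ := by
        rw [h.w_X_zero]
        simp only [mul_smul_comm, smul_mul_assoc, mul_assoc]
        rw [smul_comm]

theorem T_affine (h : IsAffineHecke q t T X w) (i j : Fin n) (hij : (i : ℕ) + 1 = j) :
    T i * (X (Fin.last n) * w) = X (Fin.last n) * w * T j := by
  rw [← mul_assoc, h.X_comm i _ (Fin.castSucc_lt_last i).ne'
    (by simp only [Ne, Fin.ext_iff, Fin.val_last, Fin.val_succ]; omega), mul_assoc,
    h.w_T i j hij, mul_assoc]

/-- Descending induction by T_i Φ = Φ T_{i+1} with Φ = x_N w. The base case relates ξ_{N-1} to ξ_N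
and needs the wrap-around relation for w². -/
theorem xi_castSucc_affine (h : IsAffineHecke q t T X w) (ht : t ≠ 0) (i : Fin n) :
    xi t T w i.castSucc * (X (Fin.last n) * w) = X (Fin.last n) * w * xi t T w i.succ := by
  cases n with
  | zero => exact i.elim0
  | succ n =>
    induction i using Fin.reverseInduction with
    | cast i ih =>
      have hT := h.T_affine i.castSucc i.succ (by simp)
      have e1 : xi t T w i.castSucc.castSucc
          = t⁻¹ • (T i.castSucc * xi t T w i.succ.castSucc * T i.castSucc) := by
        rw [xi, heckeXi_castSucc, Fin.succ_castSucc]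
      have e2 : xi t T w i.castSucc.succ
          = t⁻¹ • (T i.succ * xi t T w i.succ.succ * T i.succ) := by
        rw [xi, Fin.succ_castSucc, heckeXi_castSucc]
      rw [e1, e2, smul_mul_assoc, mul_smul_comm]
      congr 1
      generalize X (Fin.last (n + 1)) * w = Φ at *
      rw [mul_assoc, hT, ← mul_assoc, mul_assoc (T i.castSucc), ih, ← mul_assoc, hT]
      simp only [mul_assoc]
    | last =>
      have e1 : xi t T w (Fin.last n).castSucc = t⁻¹ • (T (Fin.last n) *
          (w * heckeD (heckeInv t T)) * T (Fin.last n)) := by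
        rw [xi, heckeXi_castSucc, Fin.succ_last, heckeXi_last]
      rw [e1, Fin.succ_last, xi, heckeXi_last]
      set I := heckeInv t T with hI
      set D := heckeD fun i : Fin n => I i.castSucc with hD
      set D' := heckeD fun i : Fin n => I i.succ with hD'
      have hDw : D * w = w * D' := heckeD_intertwine _ _ _ fun k =>
        heckeInv_intertwine (h.w_T _ _ (by simp))
      have hDX : D * X (Fin.last (n + 1)) = X (Fin.last (n + 1)) * D :=
        heckeD_intertwine _ _ _ fun k => heckeInv_intertwine (h.X_comm _ _
          (by simp [Fin.ext_iff]; omega) (by simp [Fin.ext_iff]; omega))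
      have hww : w * w * I 0 = I (Fin.last n) * (w * w) :=
        (heckeInv_intertwine (h.w_sq_T 0 (Fin.last n) rfl (by simp))).symm
      have hwX : w * X (Fin.last (n + 1)) = X (Fin.last n).castSucc * w := h.w_X_succ (Fin.last n)
      have hTX := h.T_X_castSucc (Fin.last n)
      rw [Fin.succ_last] at hTX
      have hD1 : heckeD I * T (Fin.last n) = D := by
        rw [heckeD_succ_last, mul_assoc, h.inv_mul ht, mul_one]
      -- Cancelling the last inverse leaves `D`, which commutes with x_N. Then w turns x_N into
      -- x_{N-1}, T_{N-1} turns it back, and w² converts the resulting T_{N-1}⁻¹ into T_1⁻¹, the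
      -- factor missing from `D'`.
      calc t⁻¹ • (T (Fin.last n) * (w * heckeD I) * T (Fin.last n)) * (X (Fin.last (n + 1)) * w)
          = t⁻¹ • (T (Fin.last n) * w * (heckeD I * T (Fin.last n)) *
              X (Fin.last (n + 1)) * w) := by simp only [mul_assoc, smul_mul_assoc]
        _ = t⁻¹ • (T (Fin.last n) * (w * X (Fin.last (n + 1))) * (D * w)) := by
            rw [hD1, mul_assoc _ D, hDX]; simp only [mul_assoc]
        _ = t⁻¹ • (T (Fin.last n) * X (Fin.last n).castSucc) * (w * w * D') := by
            rw [hwX, hDw]; simp only [mul_assoc, smul_mul_assoc]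
        _ = X (Fin.last (n + 1)) * (I (Fin.last n) * (w * w)) * D' := by
            rw [hTX]; simp only [mul_assoc, hI]
        _ = _ := by
            rw [← hww, heckeD_succ]; simp only [mul_assoc]; rfl

end IsAffineHecke

end Hecke

/-! ### The affine Hecke relations on vector-valued polynomials. -/

section Operators

variable {K : Type*} [Field K] {μ : YoungDiagram} {n : ℕ}

/-- Multiplication by `x_k`. -/
noncomputable def mulX (k : Fin (n + 1)) : Module.End K (PV K μ n) :=
  TensorProduct.map (LinearMap.mulLeft K (MvPolynomial.X k : P K n)) LinearMap.id

theorem mulX_tmul (k : Fin (n + 1)) (p : P K n) (v : V K μ n) :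
    mulX k (p ⊗ₜ[K] v) = (MvPolynomial.X k * p) ⊗ₜ[K] v := rfl

/-- Vector-valued polynomials are generated from constants by multiplications with variables. -/
theorem PV_induction {p : PV K μ n → Prop} (const : ∀ v : V K μ n, p ((1 : P K n) ⊗ₜ[K] v))
    (add : ∀ f g, p f → p g → p (f + g)) (mul : ∀ k f, p f → p (mulX k f)) (f : PV K μ n) :
    p f := by
  induction f using TensorProduct.induction_on with
  | zero => simpa using const 0
  | add f g hf hg => exact add f g hf hg
  | tmul r v =>
    induction r using MvPolynomial.induction_on with
    | C a =>
      have : (MvPolynomial.C a : P K n) ⊗ₜ[K] v = (1 : P K n) ⊗ₜ[K] (a • v) := by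
        rw [← TensorProduct.smul_tmul, MvPolynomial.smul_eq_C_mul, mul_one]
      rw [this]
      exact const _
    | add r s hr hs => rw [TensorProduct.add_tmul]; exact add _ _ hr hs
    | mul_X r k hr => rw [mul_comm, ← mulX_tmul]; exact mul k _ hr

theorem divDiff_one (i : Fin n) : divDiff K i 1 = 0 := by
  apply mul_left_cancel₀ (X_sub_X_ne_zero (K := K) i)
  rw [divDiff_spec, map_one, sub_self, mul_zero]

theorem sOp_X (i : Fin n) (k : Fin (n + 1)) :
    sOp K i (MvPolynomial.X k) = MvPolynomial.X (Equiv.swap i.castSucc i.succ k) := by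
  simp [sOp]

theorem divDiff_X_castSucc (i : Fin n) (p : P K n) :
    divDiff K i (MvPolynomial.X i.castSucc * p) = p + MvPolynomial.X i.succ * divDiff K i p := by
  apply mul_left_cancel₀ (X_sub_X_ne_zero (K := K) i)
  rw [divDiff_spec, map_mul, sOp_X, Equiv.swap_apply_left]
  linear_combination (-MvPolynomial.X i.succ) * divDiff_spec i p

theorem divDiff_X_succ (i : Fin n) (p : P K n) :
    divDiff K i (MvPolynomial.X i.succ * p) = MvPolynomial.X i.castSucc * divDiff K i p - p := by
  apply mul_left_cancel₀ (X_sub_X_ne_zero (K := K) i)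
  rw [divDiff_spec, map_mul, sOp_X, Equiv.swap_apply_right]
  linear_combination (-MvPolynomial.X i.castSucc) * divDiff_spec i p

theorem divDiff_X_of_ne (i : Fin n) (k : Fin (n + 1)) (h1 : k ≠ i.castSucc) (h2 : k ≠ i.succ)
    (p : P K n) : divDiff K i (MvPolynomial.X k * p) = MvPolynomial.X k * divDiff K i p := by
  apply mul_left_cancel₀ (X_sub_X_ne_zero (K := K) i)
  rw [divDiff_spec, map_mul, sOp_X, Equiv.swap_apply_of_ne_of_ne h1 h2]
  linear_combination (-MvPolynomial.X k) * divDiff_spec i p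

theorem T_tmul (t : K) (i : Fin n) (p : P K n) (v : V K μ n) :
    T t i (p ⊗ₜ[K] v) = ((1 - t) • (MvPolynomial.X i.succ * divDiff K i p)) ⊗ₜ[K] v
      + sOp K i p ⊗ₜ[K] tau t i v := rfl

theorem w_tmul (q t : K) (p : P K n) (v : V K μ n) :
    w q t (p ⊗ₜ[K] v) = shiftOp q n p ⊗ₜ[K] tauOmega t v := rfl

theorem T_const (t : K) (i : Fin n) (v : V K μ n) :
    T t i ((1 : P K n) ⊗ₜ[K] v) = (1 : P K n) ⊗ₜ[K] tau t i v := by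
  rw [T_tmul, divDiff_one, mul_zero, smul_zero, TensorProduct.zero_tmul, zero_add, map_one]

theorem w_const (q t : K) (v : V K μ n) :
    w q t ((1 : P K n) ⊗ₜ[K] v) = (1 : P K n) ⊗ₜ[K] tauOmega t v := by
  rw [w_tmul, map_one]

theorem T_mulX_castSucc (t : K) (i : Fin n) (f : PV K μ n) :
    T t i (mulX i.castSucc f) = mulX i.succ (T t i f) + (1 - t) • mulX i.succ f := by
  induction f using TensorProduct.induction_on with
  | zero => simp
  | add f g hf hg => simp only [map_add, hf, hg, smul_add]; abel
  | tmul p v =>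
    simp only [mulX_tmul, T_tmul, divDiff_X_castSucc, map_add, map_mul, sOp_X,
      Equiv.swap_apply_left, mul_add, smul_add, TensorProduct.add_tmul, mul_smul_comm,
      TensorProduct.smul_tmul']
    abel

theorem T_mulX_succ (t : K) (i : Fin n) (f : PV K μ n) :
    T t i (mulX i.succ f) = mulX i.castSucc (T t i f) - (1 - t) • mulX i.succ f := by
  induction f using TensorProduct.induction_on with
  | zero => simp
  | add f g hf hg => simp only [map_add, hf, hg, smul_add]; abel
  | tmul p v =>
    simp only [mulX_tmul, T_tmul, divDiff_X_succ, map_add, map_mul, sOp_X,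
      Equiv.swap_apply_right, mul_sub, smul_sub, TensorProduct.sub_tmul, mul_smul_comm,
      TensorProduct.smul_tmul', mul_left_comm (MvPolynomial.X i.castSucc : P K n)]
    abel

theorem T_mulX_of_ne (t : K) (i : Fin n) {k : Fin (n + 1)} (h1 : k ≠ i.castSucc)
    (h2 : k ≠ i.succ) (f : PV K μ n) : T t i (mulX k f) = mulX k (T t i f) := by
  induction f using TensorProduct.induction_on with
  | zero => simp
  | add f g hf hg => simp only [map_add, hf, hg]
  | tmul p v =>
    simp only [mulX_tmul, T_tmul, divDiff_X_of_ne i k h1 h2, map_add, map_mul, sOp_X,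
      Equiv.swap_apply_of_ne_of_ne h1 h2, mul_smul_comm,
      mul_left_comm (MvPolynomial.X k : P K n)]

theorem w_mulX_succ (q t : K) (i : Fin n) (f : PV K μ n) :
    w q t (mulX i.succ f) = mulX i.castSucc (w q t f) := by
  induction f using TensorProduct.induction_on with
  | zero => simp
  | add f g hf hg => simp only [map_add, hf, hg]
  | tmul p v => simp [mulX_tmul, w_tmul, shiftOp]

theorem w_mulX_zero (q t : K) (f : PV K μ n) :
    w q t (mulX 0 f) = q • mulX (Fin.last n) (w q t f) := by
  induction f using TensorProduct.induction_on with
  | zero => simp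
  | add f g hf hg => simp only [map_add, hf, hg, smul_add]
  | tmul p v =>
    simp only [mulX_tmul, w_tmul, map_mul, TensorProduct.smul_tmul', MvPolynomial.smul_eq_C_mul]
    simp [shiftOp, mul_assoc]

/-- On constants this is the relation for `tau`, and the rules for moving T_i past x_k carry it from
f to x_k f. The other Hecke relations and those with w follow the same scheme. -/
theorem T_quad {q t : K} (hg : Generic q t μ) (i : Fin n) (f : PV K μ n) :
    T t i (T t i f) = (t - 1) • T t i f + t • f := by
  induction f using PV_induction with
  | const v =>
    have := LinearMap.congr_fun ((tau_isHecke hg).quad i) v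
    simp only [Module.End.mul_apply, LinearMap.add_apply, LinearMap.smul_apply,
      Module.End.one_apply] at this
    rw [T_const, T_const, this, TensorProduct.tmul_add, TensorProduct.tmul_smul,
      TensorProduct.tmul_smul]
  | add f g hf hg => simp only [map_add, hf, hg, smul_add]; abel
  | mul k f hf =>
    by_cases h1 : k = i.castSucc
    · subst h1
      simp only [T_mulX_castSucc, T_mulX_succ, map_add, map_smul, hf]
      module
    by_cases h2 : k = i.succ
    · subst h2
      simp only [T_mulX_castSucc, T_mulX_succ, map_add, map_sub, map_smul, hf]
      module
    · simp only [T_mulX_of_ne t i h1 h2, map_add, map_smul, hf]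

theorem T_comm {q t : K} (hg : Generic q t μ) (i j : Fin n) (hij : (i : ℕ) + 1 < j)
    (f : PV K μ n) : T t i (T t j f) = T t j (T t i f) := by
  have e1 : i.castSucc ≠ j.castSucc := by simp only [Ne, Fin.ext_iff, Fin.val_castSucc]; omega
  have e2 : i.castSucc ≠ j.succ := by
    simp only [Ne, Fin.ext_iff, Fin.val_castSucc, Fin.val_succ]; omega
  have e3 : i.succ ≠ j.castSucc := by
    simp only [Ne, Fin.ext_iff, Fin.val_castSucc, Fin.val_succ]; omega
  have e4 : i.succ ≠ j.succ := by simp only [Ne, Fin.ext_iff, Fin.val_succ]; omega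
  induction f using PV_induction with
  | const v =>
    have := LinearMap.congr_fun ((tau_isHecke hg).comm i j hij) v
    simp only [Module.End.mul_apply] at this
    rw [T_const, T_const, T_const, T_const, this]
  | add f g hf hg => simp only [map_add, hf, hg]
  | mul k f hf =>
    by_cases h1 : k = i.castSucc
    · subst h1
      simp only [T_mulX_castSucc, T_mulX_of_ne t j e1 e2, T_mulX_of_ne t j e3 e4, map_add,
        map_smul, hf]
    by_cases h2 : k = i.succ
    · subst h2
      simp only [T_mulX_succ, T_mulX_of_ne t j e1 e2, T_mulX_of_ne t j e3 e4, map_sub,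
        map_smul, hf]
    by_cases h3 : k = j.castSucc
    · subst h3
      simp only [T_mulX_castSucc, T_mulX_of_ne t i e1.symm e3.symm,
        T_mulX_of_ne t i e2.symm e4.symm, map_add, map_smul, hf]
    by_cases h4 : k = j.succ
    · subst h4
      simp only [T_mulX_succ, T_mulX_of_ne t i e1.symm e3.symm,
        T_mulX_of_ne t i e2.symm e4.symm, map_sub, map_smul, hf]
    · simp only [T_mulX_of_ne t i h1 h2, T_mulX_of_ne t j h3 h4, hf]

theorem T_braid {q t : K} (hg : Generic q t μ) (i j : Fin n) (hij : (i : ℕ) + 1 = j)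
    (f : PV K μ n) : T t i (T t j (T t i f)) = T t j (T t i (T t j f)) := by
  have hj : j.castSucc = i.succ := by simp [Fin.ext_iff, ← hij]
  have n12 : j.succ ≠ i.succ := by simp only [Ne, Fin.ext_iff, Fin.val_succ]; omega
  have n02 : i.castSucc ≠ j.succ := by
    simp only [Ne, Fin.ext_iff, Fin.val_castSucc, Fin.val_succ]; omega
  have n01 : i.castSucc ≠ j.castSucc := by rw [hj]; exact (Fin.castSucc_lt_succ).ne
  have c1 := fun g : PV K μ n => T_mulX_castSucc t j g
  have c2 := fun g : PV K μ n => T_mulX_succ t j g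
  rw [hj] at c1 c2
  have c3 := fun g : PV K μ n => T_mulX_of_ne t i n02.symm n12 g
  have c4 := fun g : PV K μ n => T_mulX_of_ne t j n01 n02 g
  induction f using PV_induction with
  | const v =>
    have := LinearMap.congr_fun ((tau_isHecke hg).braid i j hij) v
    simp only [Module.End.mul_apply] at this
    simp only [T_const, this]
  | add f g hf hg => simp only [map_add, hf, hg]
  | mul k f hf =>
    by_cases h1 : k = i.castSucc
    · subst h1
      simp only [T_mulX_castSucc, c1, c3, c4, map_add, map_smul,
        hf, T_quad hg]
      module
    by_cases h2 : k = i.succ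
    · subst h2
      simp only [T_mulX_castSucc, T_mulX_succ, c1, c2, c3, c4, map_add, map_sub, map_smul,
        hf]
      module
    by_cases h3 : k = j.succ
    · subst h3
      simp only [T_mulX_succ, c1, c2, c3, c4, map_add, map_sub, map_smul,
        hf, T_quad hg]
      module
    · simp only [T_mulX_of_ne t i h1 h2, T_mulX_of_ne t j (hj ▸ h2) h3, hf]

theorem T_w {q t : K} (hg : Generic q t μ) (i j : Fin n) (hij : (i : ℕ) + 1 = j)
    (f : PV K μ n) : T t i (w q t f) = w q t (T t j f) := by
  have hj : j.castSucc = i.succ := by simp [Fin.ext_iff, ← hij]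
  have l1 : Fin.last n ≠ i.castSucc := (Fin.castSucc_lt_last i).ne'
  have l2 : Fin.last n ≠ i.succ := by
    simp only [Ne, Fin.ext_iff, Fin.val_last, Fin.val_succ]; omega
  have c1 := fun g : PV K μ n => T_mulX_castSucc t j g
  have c2 := fun g : PV K μ n => T_mulX_succ t j g
  have c3 := fun g : PV K μ n => w_mulX_succ q t j g
  rw [hj] at c1 c2 c3
  induction f using PV_induction with
  | const v =>
    have := LinearMap.congr_fun ((tau_isHecke hg).mul_heckeW i j hij) v
    rw [w_const, T_const, T_const, w_const]
    exact congrArg _ this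
  | add f g hf hg => simp only [map_add, hf, hg]
  | mul k f hf =>
    by_cases h1 : k = i.succ
    · subst h1
      simp only [w_mulX_succ, T_mulX_castSucc, c1, c3, hf, map_add, map_smul]
    by_cases h2 : k = j.succ
    · subst h2
      simp only [w_mulX_succ, T_mulX_succ, c2, c3, hf, map_sub, map_smul]
    rw [T_mulX_of_ne t j (hj ▸ h1) h2]
    induction k using Fin.cases with
    | zero => rw [w_mulX_zero, w_mulX_zero, map_smul, T_mulX_of_ne t i l1 l2, hf]
    | succ m =>
      rw [w_mulX_succ, w_mulX_succ, T_mulX_of_ne, hf]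
      · intro h; rw [Fin.castSucc_inj] at h; exact h1 (by rw [h])
      · intro h; rw [← hj, Fin.castSucc_inj] at h; exact h2 (by rw [h])

/-- w² carries x_1, x_2 to q x_{N-1}, q x_N. The common factor q lets the rules for T_1 pass to
those for T_{N-1}; the remaining variables avoid both operators. -/
theorem T_w_sq {q t : K} (hg : Generic q t μ) (i j : Fin n) (hi : (i : ℕ) = 0)
    (hj : (j : ℕ) + 1 = n) (f : PV K μ n) :
    T t j (w q t (w q t f)) = w q t (w q t (T t i f)) := by
  have hi0 : i.castSucc = 0 := Fin.ext hi
  have hjl : Fin.last n = j.succ := by simp [Fin.ext_iff, hj]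
  have a0 : ∀ g : PV K μ n, w q t (w q t (mulX i.castSucc g))
      = q • mulX j.castSucc (w q t (w q t g)) := fun g => by
    rw [hi0, w_mulX_zero, map_smul, hjl, w_mulX_succ]
  have a1 : ∀ g : PV K μ n, w q t (w q t (mulX i.succ g))
      = q • mulX j.succ (w q t (w q t g)) := fun g => by
    rw [w_mulX_succ, hi0, w_mulX_zero, hjl]
  induction f using PV_induction with
  | const v =>
    have := LinearMap.congr_fun ((tau_isHecke hg).last_mul_heckeW_sq i j hi hj) v
    simp only [w_const, T_const]
    exact congrArg _ this
  | add f g hf hg => simp only [map_add, hf, hg]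
  | mul k f hf =>
    by_cases h1 : k = i.castSucc
    · subst h1
      simp only [a0, a1, T_mulX_castSucc, hf, map_add, map_smul]
      module
    by_cases h2 : k = i.succ
    · subst h2
      simp only [a0, a1, T_mulX_succ, hf, map_sub, map_smul]
      module
    rw [T_mulX_of_ne t i h1 h2]
    simp only [Fin.ext_iff, Fin.val_castSucc, Fin.val_succ, hi] at h1 h2
    obtain ⟨m, rfl⟩ : ∃ m : Fin n, k = m.succ :=
      ⟨⟨(k : ℕ) - 1, by omega⟩, by simp only [Fin.ext_iff, Fin.val_succ]; omega⟩
    obtain ⟨m', hm⟩ : ∃ m' : Fin n, m.castSucc = m'.succ := by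
      simp only [Fin.val_succ] at h2
      exact ⟨⟨(m : ℕ) - 1, by omega⟩, by
        simp only [Fin.ext_iff, Fin.val_succ, Fin.val_castSucc]; omega⟩
    simp only [w_mulX_succ, hm]
    have hm' : (m : ℕ) = m' + 1 := by simpa [Fin.ext_iff] using hm
    have := m.isLt
    rw [T_mulX_of_ne, hf]
    · simp only [Ne, Fin.ext_iff, Fin.val_castSucc]; omega
    · simp only [Ne, Fin.ext_iff, Fin.val_castSucc, Fin.val_succ]; omega

theorem isAffineHecke {q t : K} (hg : Generic q t μ) :
    IsAffineHecke q t (T t : Fin n → Module.End K (PV K μ n)) mulX (w q t) where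
  quad i := LinearMap.ext (T_quad hg i)
  braid i j h := LinearMap.ext (T_braid hg i j h)
  comm i j h := LinearMap.ext (T_comm hg i j h)
  X_castSucc i := LinearMap.ext fun f => by
    simp only [Module.End.mul_apply, LinearMap.add_apply, LinearMap.smul_apply,
      Module.End.one_apply, map_add, map_smul, T_mulX_castSucc]
  X_comm i k h1 h2 := LinearMap.ext (T_mulX_of_ne t i h1 h2)
  w_X_succ i := LinearMap.ext (w_mulX_succ q t i)
  w_X_zero := LinearMap.ext (w_mulX_zero q t)
  w_T i j h := LinearMap.ext (T_w hg i j h)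
  w_sq_T i j hi hj := LinearMap.ext (T_w_sq hg i j hi hj)

/-- The Cherednik operators on vector-valued polynomials. -/
noncomputable def xi (q t : K) (k : Fin (n + 1)) : Module.End K (PV K μ n) :=
  IsAffineHecke.xi t (T t) (w q t) k

theorem xi_last (q t : K) : (xi q t (Fin.last n) : Module.End K (PV K μ n)) = xiLast q t :=
  heckeXi_last _ _ _

theorem xi_castSucc (q t : K) (i : Fin n) (f : PV K μ n) :
    xi q t i.castSucc f = t⁻¹ • T t i (xi q t i.succ (T t i f)) :=
  LinearMap.congr_fun (heckeXi_castSucc t (T t) _ i) f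

/-! ### The Jucys–Murphy elements -/

/-- On the span of S and S^{(i)} the element with index i + 1 is diagonal with the two content
powers interchanged. Conjugating by the 2×2 block of T_i and dividing by t yields the eigenvalue for
i. -/
theorem jucysMurphy_single {q t : K} (hg : Generic q t μ) (k : Fin (n + 1)) :
    ∀ S : RSYT μ n, heckeXi t (tau t) (1 : Module.End K (V K μ n)) k (Finsupp.single S 1)
      = t ^ S.content k • Finsupp.single S 1 := by
  induction k using Fin.reverseInduction with
  | last => intro S; rw [heckeXi_last, S.content_last, zpow_zero, one_smul, Module.End.one_apply]
  | cast i ih =>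
    intro S
    have hne := S.zpow_content_ne hg (Fin.castSucc_lt_succ (i := i)) (by simp)
    have hm := S.exchCoeff_mul hg i
    have ha := diagCoeff_add_swap (x := (S.pos i.castSucc).1) (y := (S.pos i.succ).1) hne
    have hd : diagCoeff t (S.pos i.castSucc).1 (S.pos i.succ).1
        * (t ^ S.content i.castSucc - t ^ S.content i.succ) = (t - 1) * t ^ S.content i.castSucc :=
      div_mul_cancel₀ _ (sub_ne_zero.2 hne)
    have hs : (Equiv.swap i.castSucc i.succ).trans ((Equiv.swap i.castSucc i.succ).trans S.pos)
        = S.pos := by ext k : 1; simp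
    rw [heckeXi_castSucc]
    apply toFilling_injective
    simp only [LinearMap.smul_apply, Module.End.mul_apply, map_smul]
    -- The induction hypothesis speaks only of tableaux, so the case where the exchange is absent is
    -- treated separately.
    have key : toFilling K μ n (heckeXi t (tau t) (1 : Module.End K (V K μ n)) i.succ
          (tau t i (Finsupp.single S 1)))
        = (t ^ S.content i.succ * diagCoeff t (S.pos i.castSucc).1 (S.pos i.succ).1)
            • Finsupp.single S.pos 1
          + (t ^ S.content i.castSucc * exchCoeff t (S.pos i.castSucc).1 (S.pos i.succ).1)
            • Finsupp.single ((Equiv.swap i.castSucc i.succ).trans S.pos) 1 := by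
      rcases S.exchange_cases t i with h0 | ⟨S', hS'⟩
      · have : tau t i (Finsupp.single S 1)
            = diagCoeff t (S.pos i.castSucc).1 (S.pos i.succ).1 • Finsupp.single S 1 := by
          apply toFilling_injective
          rw [toFilling_tau hg, toFilling_single, fillingOp_single, h0, map_smul, toFilling_single,
            zero_smul, add_zero]
        rw [this, map_smul, ih, h0, map_smul, map_smul, toFilling_single, mul_zero, zero_smul,
          add_zero, smul_smul, mul_comm]
      · have : tau t i (Finsupp.single S 1)
            = diagCoeff t (S.pos i.castSucc).1 (S.pos i.succ).1 • Finsupp.single S 1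
              + exchCoeff t (S.pos i.castSucc).1 (S.pos i.succ).1 • Finsupp.single S' 1 := by
          apply toFilling_injective
          rw [toFilling_tau hg, toFilling_single, fillingOp_single, map_add, map_smul, map_smul,
            toFilling_single, toFilling_single, hS']
        have hc : S'.content i.succ = S.content i.castSucc := by
          rw [S'.content_eq, S.content_eq, hS', Equiv.trans_apply, Equiv.swap_apply_right]
        rw [this, map_add, map_smul, map_smul, ih, ih, hc, map_add, map_smul, map_smul, map_smul,
          map_smul, toFilling_single, toFilling_single, hS', smul_smul, smul_smul, mul_comm,
          mul_comm (exchCoeff _ _ _)]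
    rw [toFilling_tau hg, key]
    simp only [map_add, map_smul, toFilling_single, fillingOp_single, Equiv.trans_apply,
      Equiv.swap_apply_left, Equiv.swap_apply_right, hs, ha]
    have ht := hg.t_ne_zero
    generalize diagCoeff t (S.pos i.castSucc).1 (S.pos i.succ).1 = a at *
    match_scalars
    · field_simp
      linear_combination (t ^ S.content i.castSucc) * hm - a * hd
    · field_simp
      linear_combination (- exchCoeff t (S.pos i.castSucc).1 (S.pos i.succ).1) * hd

/-- On constants w acts as τ(ω), which cancels the inverses in ξ_N. Hence ξ_N acts as the identity
and the ξ_k become Jucys–Murphy elements. -/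
theorem xi_const {q t : K} (hg : Generic q t μ) (k : Fin (n + 1)) (v : V K μ n) :
    xi q t k ((1 : P K n) ⊗ₜ[K] v)
      = (1 : P K n) ⊗ₜ[K] heckeXi t (tau t) (1 : Module.End K (V K μ n)) k v := by
  induction k using Fin.reverseInduction generalizing v with
  | last =>
    have hD : ∀ v : V K μ n, TinvDesc t ((1 : P K n) ⊗ₜ[K] v)
        = (1 : P K n) ⊗ₜ[K] heckeD (heckeInv t (tau t)) v := by
      have : ∀ (l : List (Fin n)) (v : V K μ n),
          ((l.map (Tinv t)).prod : Module.End K (PV K μ n)) ((1 : P K n) ⊗ₜ[K] v)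
            = (1 : P K n) ⊗ₜ[K] (l.map (heckeInv t (tau t))).prod v := by
        intro l
        induction l with
        | nil => intro v; simp
        | cons a l ih =>
          intro v
          simp only [List.map_cons, List.prod_cons, Module.End.mul_apply, ih]
          simp only [Tinv, heckeInv, LinearMap.smul_apply, LinearMap.add_apply,
            Module.End.one_apply, T_const, TensorProduct.tmul_add, TensorProduct.tmul_smul]
      exact this _
    have hW : tauOmega t (heckeD (heckeInv t (tau t)) v) = v :=
      LinearMap.congr_fun (heckeW_mul_heckeD (tau t) (heckeInv t (tau t))
        ((tau_isHecke hg).mul_inv hg.t_ne_zero)) v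
    rw [xi_last, heckeXi_last, xiLast, Module.End.mul_apply, hD, w_const, hW, Module.End.one_apply]
  | cast i ih =>
    rw [xi_castSucc, heckeXi_castSucc, T_const, ih, T_const, LinearMap.smul_apply,
      TensorProduct.tmul_smul]
    rfl

end Operators

/-! ### Combinatorics of compositions -/

section Compositions

variable {n : ℕ}

theorem affine_castSucc (α : Fin (n + 1) → ℕ) (i : Fin n) : affine α i.castSucc = α i.succ := by
  simp [affine]

theorem affine_last (α : Fin (n + 1) → ℕ) : affine α (Fin.last n) = α 0 + 1 := by
  simp [affine]

theorem affineInv_affine (α : Fin (n + 1) → ℕ) : affineInv (affine α) = α := by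
  ext k
  induction k using Fin.cases with
  | zero => simp [affineInv, affine_last]
  | succ k => simp [affineInv, affine_castSucc]

theorem affine_affineInv (α : Fin (n + 1) → ℕ) (h : α (Fin.last n) ≠ 0) :
    affine (affineInv α) = α := by
  ext k
  induction k using Fin.lastCases with
  | last => rw [affine_last]; simp only [affineInv, Fin.cons_zero]; omega
  | cast k => simp [affine_castSucc, affineInv]

theorem swapAt_castSucc (α : Fin (n + 1) → ℕ) (i : Fin n) :
    swapAt α i i.castSucc = α i.succ := by simp [swapAt]

theorem swapAt_succ (α : Fin (n + 1) → ℕ) (i : Fin n) :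
    swapAt α i i.succ = α i.castSucc := by simp [swapAt]

theorem swapAt_of_ne (α : Fin (n + 1) → ℕ) (i : Fin n) {k : Fin (n + 1)} (h1 : k ≠ i.castSucc)
    (h2 : k ≠ i.succ) : swapAt α i k = α k := by
  rw [swapAt, Equiv.swap_apply_of_ne_of_ne h1 h2]

theorem swapAt_swapAt (α : Fin (n + 1) → ℕ) (i : Fin n) : swapAt (swapAt α i) i = α := by
  ext k; simp [swapAt]

theorem swapAt_comm (α : Fin (n + 1) → ℕ) (i j : Fin n) (hij : (i : ℕ) + 1 < j) :
    swapAt (swapAt α i) j = swapAt (swapAt α j) i :=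
  funext fun k => congrArg α (swap_swap_comm i j hij k)

theorem swapAt_braid (α : Fin (n + 1) → ℕ) (i j : Fin n) (hij : (i : ℕ) + 1 = j) :
    swapAt (swapAt (swapAt α i) j) i = swapAt (swapAt (swapAt α j) i) j :=
  funext fun k => congrArg α (swap_swap_braid i j hij k)

theorem affine_swapAt (α : Fin (n + 1) → ℕ) (i j : Fin n) (hij : (i : ℕ) + 1 = j) :
    affine (swapAt α j) = swapAt (affine α) i := by
  have hj : i.succ = j.castSucc := by simp [Fin.ext_iff, hij]
  ext k
  by_cases h1 : k = i.castSucc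
  · subst h1; rw [swapAt_castSucc, affine_castSucc, hj, swapAt_castSucc, affine_castSucc]
  by_cases h2 : k = i.succ
  · subst h2; rw [swapAt_succ, hj, affine_castSucc, swapAt_succ, affine_castSucc, hj]
  rw [swapAt_of_ne _ _ h1 h2]
  induction k using Fin.lastCases with
  | last =>
    rw [affine_last, affine_last, swapAt_of_ne]
    · simp only [Ne, Fin.ext_iff, Fin.val_castSucc, Fin.val_zero]; omega
    · simp only [Ne, Fin.ext_iff, Fin.val_succ, Fin.val_zero]; omega
  | cast k =>
    rw [affine_castSucc, affine_castSucc, swapAt_of_ne]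
    · simp only [Ne, Fin.ext_iff, Fin.val_castSucc, Fin.val_succ] at h1 ⊢; omega
    · simp only [Ne, Fin.ext_iff, Fin.val_castSucc, Fin.val_succ] at h2 ⊢; omega

theorem affine_affine_swapAt (α : Fin (n + 1) → ℕ) (i j : Fin n) (hi : (i : ℕ) = 0)
    (hj : (j : ℕ) + 1 = n) :
    affine (affine (swapAt α i)) = swapAt (affine (affine α)) j := by
  have hi0 : i.castSucc = 0 := Fin.ext hi
  have hjl : Fin.last n = j.succ := by simp [Fin.ext_iff, hj]
  ext k
  by_cases h1 : k = j.castSucc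
  · subst h1
    rw [swapAt_castSucc, affine_castSucc, ← hjl, affine_last, affine_last, ← hi0,
      affine_castSucc, swapAt_castSucc]
  by_cases h2 : k = j.succ
  · subst h2
    rw [swapAt_succ, affine_castSucc, ← hjl, affine_last, affine_last, ← hi0, affine_castSucc,
      swapAt_succ]
  rw [swapAt_of_ne _ _ h1 h2]
  simp only [Fin.ext_iff, Fin.val_castSucc, Fin.val_succ] at h1 h2
  have hk := k.isLt
  obtain ⟨m, rfl⟩ : ∃ m : Fin n, k = m.castSucc := ⟨⟨k, by omega⟩, rfl⟩
  rw [Fin.val_castSucc] at h1 h2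
  obtain ⟨m', hm⟩ : ∃ m' : Fin n, m.succ = m'.castSucc :=
    ⟨⟨(m : ℕ) + 1, by omega⟩, by simp [Fin.ext_iff]⟩
  rw [affine_castSucc, affine_castSucc, hm, affine_castSucc, affine_castSucc, swapAt_of_ne]
  · simp only [Ne, Fin.ext_iff, Fin.val_castSucc, Fin.val_succ] at hm ⊢; omega
  · simp only [Ne, Fin.ext_iff, Fin.val_castSucc, Fin.val_succ] at hm ⊢; omega

theorem swap_lt_swap_iff (i : Fin n) {k l : Fin (n + 1)}
    (h1 : ¬ (k = i.castSucc ∧ l = i.succ)) (h2 : ¬ (k = i.succ ∧ l = i.castSucc)) :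
    Equiv.swap i.castSucc i.succ k < Equiv.swap i.castSucc i.succ l ↔ k < l := by
  constructor
  · exact fun h => RSYT.lt_of_swap_lt i l k h fun h' => h2 ⟨h'.2, h'.1⟩
  · intro h
    refine RSYT.lt_of_swap_lt i _ _ (by simpa using h) ?_
    rintro ⟨e1, e2⟩
    rw [Equiv.swap_apply_eq_iff] at e1 e2
    rw [Equiv.swap_apply_left] at e1
    rw [Equiv.swap_apply_right] at e2
    exact h1 ⟨e2, e1⟩

/-- Only the order of the positions i, i + 1 changes, and it would matter only for a tie. -/
theorem rank_swapAt (α : Fin (n + 1) → ℕ) (i : Fin n) (h : α i.castSucc ≠ α i.succ)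
    (k : Fin (n + 1)) : rank (swapAt α i) k = rank α (Equiv.swap i.castSucc i.succ k) := by
  apply Fin.ext
  simp only [rank]
  congr 1
  · refine card_equiv (Equiv.swap i.castSucc i.succ) fun j => ?_
    rw [mem_filter, mem_filter]
    simp [swapAt]
  · refine card_equiv (Equiv.swap i.castSucc i.succ) fun j => ?_
    simp only [mem_filter, mem_univ, true_and]
    simp only [swapAt]
    refine and_congr_left fun hj => (swap_lt_swap_iff i ?_ ?_).symm
    · rintro ⟨rfl, rfl⟩
      rw [Equiv.swap_apply_left, Equiv.swap_apply_right] at hj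
      exact h hj.symm
    · rintro ⟨rfl, rfl⟩
      rw [Equiv.swap_apply_left, Equiv.swap_apply_right] at hj
      exact h hj

theorem rank_zero (i : Fin (n + 1)) : rank (0 : Fin (n + 1) → ℕ) i = i := by
  apply Fin.ext
  simp [rank, filter_gt_eq_Iio]

/-- If α_1 ties with the given entry, it used to count as an earlier equal entry; raised by one and
moved to the end, it counts as a larger one. -/
theorem rank_affine_castSucc (α : Fin (n + 1) → ℕ) (i : Fin n) :
    rank (affine α) i.castSucc = rank α i.succ := by
  apply Fin.ext
  simp only [rank, card_filter]
  rw [Fin.sum_univ_castSucc, Fin.sum_univ_castSucc, Fin.sum_univ_succ, Fin.sum_univ_succ]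
  simp only [affine_castSucc, affine_last, Fin.castSucc_lt_castSucc_iff, Fin.succ_lt_succ_iff,
    Fin.succ_pos, true_and, (Fin.castSucc_lt_last i).not_gt, false_and, if_false]
  split_ifs <;> omega

theorem rank_affine_last (α : Fin (n + 1) → ℕ) :
    rank (affine α) (Fin.last n) = rank α 0 := by
  apply Fin.ext
  simp only [rank, card_filter]
  rw [Fin.sum_univ_castSucc, Fin.sum_univ_castSucc, Fin.sum_univ_succ, Fin.sum_univ_succ]
  simp only [affine_castSucc, affine_last, Fin.castSucc_lt_last, true_and, lt_irrefl, false_and,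
    if_false, Fin.not_lt_zero, sum_const_zero, add_zero, zero_add]
  rw [← sum_add_distrib]
  refine sum_congr rfl fun j _ => ?_
  split_ifs <;> omega

/-- Induction on the degree, then on the weight that decreases along the steps `s_i`. -/
theorem composition_induction {p : (Fin (n + 1) → ℕ) → Prop}
    (h : ∀ β, (∀ α, ∑ k, α k < ∑ k, β k → p α) → (∀ α, ∑ k, α k = ∑ k, β k →
      ∑ k : Fin (n + 1), α k * (n - (k : ℕ)) < ∑ k : Fin (n + 1), β k * (n - (k : ℕ)) → p α) →
      p β) (β : Fin (n + 1) → ℕ) : p β := by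
  have : ∀ d w : ℕ, ∀ β : Fin (n + 1) → ℕ, ∑ k, β k = d →
      ∑ k : Fin (n + 1), β k * (n - (k : ℕ)) = w → p β := by
    intro d
    induction d using Nat.strong_induction_on with
    | _ d ihd =>
      intro w
      induction w using Nat.strong_induction_on with
      | _ w ihw =>
        intro β hd hw
        refine h β (fun α hα => ihd _ (hd ▸ hα) _ α rfl rfl) fun α h1 h2 => ?_
        exact ihw _ (hw ▸ h2) α (h1.trans hd) rfl
  exact this _ _ β rfl rfl

theorem exists_last_ne_zero (α : Fin (n + 1) → ℕ) (h : α ≠ 0) (hl : α (Fin.last n) = 0) :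
    ∃ i : Fin n, α i.castSucc ≠ 0 ∧ ∀ j, i.castSucc < j → α j = 0 := by
  obtain ⟨k, hk⟩ := Function.ne_iff.1 h
  have hne : (univ.filter fun k => α k ≠ 0).Nonempty := ⟨k, by simpa using hk⟩
  obtain ⟨m, hm, hmax⟩ := exists_max_image _ id hne
  simp only [mem_filter, mem_univ, true_and, id] at hm hmax
  induction m using Fin.lastCases with
  | last => exact absurd hl hm
  | cast i =>
    refine ⟨i, hm, fun j hj => ?_⟩
    by_contra hne
    exact (hmax j hne).not_gt hj

theorem plus_swapAt (α : Fin (n + 1) → ℕ) (i : Fin n) : plus (swapAt α i) = plus α := by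
  funext k
  exact congrFun (Tuple.comp_perm_comp_sort_eq_comp_sort (f := α)
    (σ := Equiv.swap i.castSucc i.succ)) k.rev

theorem plus_of_antitone (α : Fin (n + 1) → ℕ) (h : Antitone α) : plus α = α := by
  have h1 : α ∘ Fin.revPerm = α ∘ Tuple.sort α :=
    Tuple.comp_sort_eq_comp_iff_monotone.2 fun a b hab => h (Fin.rev_le_rev.2 hab)
  funext k
  have := congrFun h1 k.rev
  simp only [Function.comp_apply, Fin.revPerm_apply, Fin.rev_rev] at this
  exact this.symm

end Compositions

/-! ### Spectral vectors and the product ℰ. -/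

section Spectral

variable {K : Type*} [Field K] {μ : YoungDiagram} {n : ℕ} {q t : K}

theorem zeta_swapAt (α : Fin (n + 1) → ℕ) (S : RSYT μ n) (i : Fin n)
    (h : α i.castSucc ≠ α i.succ) (k : Fin (n + 1)) :
    zeta q t (swapAt α i) S k = zeta q t α S (Equiv.swap i.castSucc i.succ k) := by
  rw [zeta, rank_swapAt α i h]
  rfl

theorem zeta_zero (S : RSYT μ n) (k : Fin (n + 1)) : zeta q t 0 S k = t ^ S.content k := by
  rw [zeta, rank_zero]
  simp

theorem zeta_affine_castSucc (α : Fin (n + 1) → ℕ) (S : RSYT μ n) (i : Fin n) :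
    zeta q t (affine α) S i.castSucc = zeta q t α S i.succ := by
  rw [zeta, rank_affine_castSucc, affine_castSucc, zeta]

theorem zeta_affine_last (α : Fin (n + 1) → ℕ) (S : RSYT μ n) :
    zeta q t (affine α) S (Fin.last n) = q * zeta q t α S 0 := by
  rw [zeta, rank_affine_last, affine_last, zeta, pow_succ']
  ring

theorem zeta_ne_zero (hg : Generic q t μ) (α : Fin (n + 1) → ℕ) (S : RSYT μ n)
    (k : Fin (n + 1)) : zeta q t α S k ≠ 0 :=
  mul_ne_zero (pow_ne_zero _ hg.q_ne_zero) (zpow_ne_zero _ hg.t_ne_zero)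

theorem zeta_div (hg : Generic q t μ) (α : Fin (n + 1) → ℕ) (S : RSYT μ n) {k l : Fin (n + 1)}
    (h : α k < α l) : zeta q t α S l / zeta q t α S k
      = q ^ (α l - α k) * t ^ (S.content (rank α l) - S.content (rank α k)) := by
  have hq := hg.q_ne_zero
  have ht := zpow_ne_zero (S.content (rank α k)) hg.t_ne_zero
  rw [zeta, zeta, zpow_sub₀ hg.t_ne_zero, pow_sub₀ _ hq h.le]
  field_simp

theorem zeta_ne (hg : Generic q t μ) (α : Fin (n + 1) → ℕ) (S : RSYT μ n) {k l : Fin (n + 1)}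
    (h : α k < α l) : zeta q t α S l ≠ zeta q t α S k := by
  intro he
  have h1 := zeta_div hg α S h
  rw [he, div_self (zeta_ne_zero hg α S k)] at h1
  exact hg.ne_one _ _ _ (S.pos_mem _) (S.pos_mem _) (Or.inl (by omega)) h1.symm

theorem E_of_antitone (α : Fin (n + 1) → ℕ) (S : RSYT μ n) (h : Antitone α) :
    E q t α S = 1 := by
  rw [E, filter_false_of_mem, prod_empty]
  rintro p - ⟨h1, h2⟩
  exact (h h1.le).not_gt h2

/-- The transposition matches all other ascending pairs, and ranks travel with their entries. The
pair (i, i+1) becomes a descent and leaves the product. -/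
theorem E_eq_mul_E_swapAt (hg : Generic q t μ) (α : Fin (n + 1) → ℕ) (S : RSYT μ n) (i : Fin n)
    (h : α i.castSucc < α i.succ) :
    E q t α S = u t (zeta q t α S i.succ / zeta q t α S i.castSucc) * E q t (swapAt α i) S := by
  have hmem : (i.castSucc, i.succ) ∈ (univ : Finset (Fin (n + 1) × Fin (n + 1))).filter
      (fun p => p.1 < p.2 ∧ α p.1 < α p.2) := by
    simp [h]
  rw [E, ← mul_prod_erase _ _ hmem, zeta_div hg α S h]
  congr 1
  refine prod_equiv ((Equiv.swap i.castSucc i.succ).prodCongr (Equiv.swap i.castSucc i.succ))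
    ?_ ?_
  · rintro ⟨k, l⟩
    simp only [mem_erase, mem_filter, mem_univ, true_and, Equiv.prodCongr_apply, Prod.map_apply,
      Ne, Prod.mk.injEq]
    simp only [swapAt, Equiv.swap_apply_self]
    by_cases h1 : k = i.castSucc ∧ l = i.succ
    · obtain ⟨rfl, rfl⟩ := h1
      simp [(Fin.castSucc_lt_succ (i := i)).not_gt]
    by_cases h2 : k = i.succ ∧ l = i.castSucc
    · obtain ⟨rfl, rfl⟩ := h2
      simp [(Fin.castSucc_lt_succ (i := i)).not_gt, h.not_gt]
    rw [swap_lt_swap_iff i h1 h2]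
    simp [h1]
  · rintro ⟨k, l⟩ -
    simp only [Equiv.prodCongr_apply, Prod.map_apply, rank_swapAt α i h.ne, swapAt,
      Equiv.swap_apply_self]

end Spectral

section Macdonald

variable {K : Type*} [Field K] {μ : YoungDiagram} {n : ℕ} {q t : K}

/-! ### The recursion for the Macdonald polynomials -/

/-- The affine step of the Yang–Baxter graph. -/
noncomputable def affineStep (q t : K) : Module.End K (PV K μ n) := mulXLast * w q t

theorem M_zero (S : RSYT μ n) : M q t 0 S = pureTensor 1 S := by
  rw [M]
  simp

theorem M_affine (α : Fin (n + 1) → ℕ) (S : RSYT μ n) :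
    M q t (affine α) S = affineStep q t (M q t α S) := by
  rw [M, if_pos (by simp [affine_last]), affineInv_affine]
  rfl

theorem M_of_last_ne_zero (α : Fin (n + 1) → ℕ) (S : RSYT μ n) (hl : α (Fin.last n) = 0)
    (i : Fin n) (hi : α i.castSucc ≠ 0) (h : ∀ j, i.castSucc < j → α j = 0) :
    M q t α S = ybStep q t (swapAt α i) S i (M q t (swapAt α i) S) := by
  have hex : ∃ i : Fin n, α i.castSucc ≠ 0 ∧ ∀ j, i.castSucc < j → α j = 0 := ⟨i, hi, h⟩
  -- The last nonzero position is unique, so the choice in the definition of `M` is forced.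
  have huniq : hex.choose = i := by
    have h1 := hex.choose_spec
    rcases lt_trichotomy hex.choose i with hlt | he | hlt
    · exact absurd (h1.2 _ (Fin.castSucc_lt_castSucc_iff.2 hlt)) hi
    · exact he
    · exact absurd (h _ (Fin.castSucc_lt_castSucc_iff.2 hlt)) h1.1
  rw [M, if_neg (by simpa using hl), dif_pos hex, huniq]

/-- The coefficient of the step with spectral quotient `z`. -/
def ybCoeff (t z : K) : K := (t - 1) / (z - 1)

theorem ybStep_eq (α : Fin (n + 1) → ℕ) (S : RSYT μ n) (i : Fin n) (f : PV K μ n) :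
    ybStep q t α S i f
      = T t i f + ybCoeff t (zeta q t α S i.succ / zeta q t α S i.castSucc) • f := rfl

/-! ### Eigenvectors of the Cherednik operators -/

/-- `f` is a joint eigenvector of the Cherednik operators with spectral vector `z`. -/
def IsSpectral (q t : K) (z : Fin (n + 1) → K) (f : PV K μ n) : Prop :=
  ∀ k, xi q t k f = z k • f

theorem isSpectral_const (hg : Generic q t μ) (S : RSYT μ n) :
    IsSpectral q t (zeta q t 0 S) (pureTensor 1 S : PV K μ n) := by
  intro k
  rw [pureTensor, xi_const hg, jucysMurphy_single hg, zeta_zero, TensorProduct.tmul_smul]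

theorem isSpectral_affineStep (hg : Generic q t μ) {α : Fin (n + 1) → ℕ} {S : RSYT μ n}
    {f : PV K μ n} (hf : IsSpectral q t (zeta q t α S) f) :
    IsSpectral q t (zeta q t (affine α) S) (affineStep q t f) := by
  intro k
  induction k using Fin.lastCases with
  | last =>
    have := LinearMap.congr_fun ((isAffineHecke (n := n) hg).xi_last_affine hg.t_ne_zero) f
    refine this.trans ?_
    rw [zeta_affine_last, mul_smul]
    change q • affineStep q t (xi q t 0 f) = _
    rw [hf, map_smul]
  | cast i =>
    have := LinearMap.congr_fun ((isAffineHecke (n := n) hg).xi_castSucc_affine hg.t_ne_zero i) f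
    refine this.trans ?_
    rw [zeta_affine_castSucc]
    change affineStep q t (xi q t i.succ f) = _
    rw [hf, map_smul]

theorem T_xi_castSucc (hg : Generic q t μ) (i : Fin n) (f : PV K μ n) :
    xi q t i.castSucc (T t i f) = (t - 1) • xi q t i.castSucc f + T t i (xi q t i.succ f) := by
  have ht := hg.t_ne_zero
  rw [xi_castSucc, xi_castSucc, T_quad hg]
  simp only [map_add, map_smul]
  match_scalars <;> field_simp

theorem T_xi_succ (hg : Generic q t μ) (i : Fin n) (f : PV K μ n) :
    xi q t i.succ (T t i f) = T t i (xi q t i.castSucc f) - (t - 1) • xi q t i.castSucc f := by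
  have ht := hg.t_ne_zero
  rw [xi_castSucc, map_smul, T_quad hg]
  match_scalars
  · field_simp
  · ring

/-- T_i interchanges the eigenvalues ζ(i), ζ(i+1) up to a multiple of f; the coefficient c of the
step solves c (ζ(i+1) - ζ(i)) = (t-1) ζ(i), which absorbs it. -/
theorem isSpectral_ybStep (hg : Generic q t μ) {α : Fin (n + 1) → ℕ} {S : RSYT μ n} {i : Fin n}
    (hi : α i.castSucc < α i.succ) {f : PV K μ n} (hf : IsSpectral q t (zeta q t α S) f) :
    IsSpectral q t (zeta q t (swapAt α i) S) (ybStep q t α S i f) := by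
  have h0 := zeta_ne_zero hg α S i.castSucc
  have h1 := zeta_ne hg α S hi
  have hc : ybCoeff t (zeta q t α S i.succ / zeta q t α S i.castSucc)
      * (zeta q t α S i.succ - zeta q t α S i.castSucc) = (t - 1) * zeta q t α S i.castSucc := by
    have := sub_ne_zero.2 h1
    rw [ybCoeff]
    field_simp
  intro k
  rw [zeta_swapAt α S i hi.ne, ybStep_eq, map_add, map_smul]
  generalize ybCoeff t (zeta q t α S i.succ / zeta q t α S i.castSucc) = c at *
  by_cases hk1 : k = i.castSucc
  · subst hk1
    rw [T_xi_castSucc hg, hf, hf, Equiv.swap_apply_left, map_smul]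
    match_scalars
    · linear_combination -hc
    · ring
  by_cases hk2 : k = i.succ
  · subst hk2
    rw [T_xi_succ hg, hf, hf, Equiv.swap_apply_right, map_smul]
    match_scalars
    · ring
    · linear_combination hc
  · have hT : xi q t k (T t i f) = T t i (xi q t k f) :=
      (LinearMap.congr_fun ((isAffineHecke (n := n) hg).T_xi hg.t_ne_zero i k hk1 hk2) f).symm
    rw [hT, hf, Equiv.swap_apply_of_ne_of_ne hk1 hk2, map_smul, smul_add, smul_comm]

theorem isSpectral_M (hg : Generic q t μ) (S : RSYT μ n) (α : Fin (n + 1) → ℕ) :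
    IsSpectral q t (zeta q t α S) (M q t α S) := by
  induction α using composition_induction with
  | h β ih1 ih2 =>
    by_cases hl : β (Fin.last n) = 0
    · by_cases h0 : β = 0
      · subst h0; rw [M_zero]; exact isSpectral_const hg S
      obtain ⟨i, hi, h⟩ := exists_last_ne_zero β h0 hl
      have h' := h i.succ Fin.castSucc_lt_succ
      rw [M_of_last_ne_zero β S hl i hi h]
      have := ih2 (swapAt β i) (sum_swapAt β i) (weight_swapAt_lt β i (by omega))
      have := isSpectral_ybStep hg (i := i) (by rw [swapAt_castSucc, swapAt_succ]; omega) this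
      rwa [swapAt_swapAt] at this
    · have := isSpectral_affineStep hg (ih1 _ (sum_affineInv_lt β hl))
      rwa [← M_affine, affine_affineInv β hl] at this

/-! ### Independence of the path -/

theorem affineStep_T (hg : Generic q t μ) (i j : Fin n) (hij : (i : ℕ) + 1 = j) (f : PV K μ n) :
    T t i (affineStep q t f) = affineStep q t (T t j f) :=
  LinearMap.congr_fun ((isAffineHecke (n := n) hg).T_affine i j hij) f

theorem T_mulX_mulX (t : K) (i : Fin n) (f : PV K μ n) :
    T t i (mulX i.succ (mulX i.castSucc f)) = mulX i.succ (mulX i.castSucc (T t i f)) := by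
  have hcomm : ∀ g : PV K μ n,
      mulX i.castSucc (mulX i.succ g) = mulX i.succ (mulX i.castSucc g) := by
    intro g
    induction g using TensorProduct.induction_on with
    | zero => simp
    | add f g hf hg => simp only [map_add, hf, hg]
    | tmul p v => simp only [mulX_tmul, mul_left_comm]
  rw [T_mulX_succ, T_mulX_castSucc, map_add, map_smul, hcomm, hcomm]
  abel

/-- Two affine steps amount to w² followed by multiplication by x_{N-1} x_N, which is symmetric and
so commutes with T_{N-1}. -/
theorem affineStep_affineStep_T (hg : Generic q t μ) (i j : Fin n) (hi : (i : ℕ) = 0)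
    (hj : (j : ℕ) + 1 = n) (f : PV K μ n) :
    T t j (affineStep q t (affineStep q t f)) = affineStep q t (affineStep q t (T t i f)) := by
  have hjl : Fin.last n = j.succ := by simp [Fin.ext_iff, hj]
  have key : ∀ f : PV K μ n, affineStep q t (affineStep q t f)
      = mulX j.succ (mulX j.castSucc (w q t (w q t f))) := fun f => by
    rw [← w_mulX_succ, ← hjl]
    rfl
  rw [key, key, T_mulX_mulX, T_w_sq hg i j hi hj]

theorem ybStep_affineStep (hg : Generic q t μ) (i j : Fin n) (hij : (i : ℕ) + 1 = j)
    (α : Fin (n + 1) → ℕ) (S : RSYT μ n) (f : PV K μ n) :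
    ybStep q t (affine α) S i (affineStep q t f) = affineStep q t (ybStep q t α S j f) := by
  have hj : i.succ = j.castSucc := by simp [Fin.ext_iff, hij]
  rw [ybStep_eq, ybStep_eq, affineStep_T hg i j hij, zeta_affine_castSucc, hj,
    zeta_affine_castSucc, map_add, map_smul]

/-- Both eigenvalues acquire one factor q, so their quotient and the coefficient of the step are
unchanged. -/
theorem ybStep_affineStep_affineStep (hg : Generic q t μ) (i j : Fin n) (hi : (i : ℕ) = 0)
    (hj : (j : ℕ) + 1 = n) (α : Fin (n + 1) → ℕ) (S : RSYT μ n) (f : PV K μ n) :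
    ybStep q t (affine (affine α)) S j (affineStep q t (affineStep q t f))
      = affineStep q t (affineStep q t (ybStep q t α S i f)) := by
  have hi0 : 0 = i.castSucc := Fin.ext hi.symm
  have hjl : j.succ = Fin.last n := by simp [Fin.ext_iff, hj]
  rw [ybStep_eq, ybStep_eq, affineStep_affineStep_T hg i j hi hj, zeta_affine_castSucc, hjl,
    zeta_affine_last, zeta_affine_last, hi0, zeta_affine_castSucc,
    mul_div_mul_left _ _ hg.q_ne_zero, map_add, map_add, map_smul, map_smul]

theorem ybStep_comm (hg : Generic q t μ) (i j : Fin n) (hij : (i : ℕ) + 1 < j)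
    (α : Fin (n + 1) → ℕ) (S : RSYT μ n) (f : PV K μ n)
    (hi : α i.castSucc ≠ α i.succ) (hj : α j.castSucc ≠ α j.succ) :
    ybStep q t (swapAt α i) S j (ybStep q t α S i f)
      = ybStep q t (swapAt α j) S i (ybStep q t α S j f) := by
  have e1 : i.castSucc ≠ j.castSucc := by simp only [Ne, Fin.ext_iff, Fin.val_castSucc]; omega
  have e2 : i.castSucc ≠ j.succ := by
    simp only [Ne, Fin.ext_iff, Fin.val_castSucc, Fin.val_succ]; omega
  have e3 : i.succ ≠ j.castSucc := by
    simp only [Ne, Fin.ext_iff, Fin.val_castSucc, Fin.val_succ]; omega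
  have e4 : i.succ ≠ j.succ := by simp only [Ne, Fin.ext_iff, Fin.val_succ]; omega
  simp only [ybStep_eq, zeta_swapAt α S i hi, zeta_swapAt α S j hj,
    Equiv.swap_apply_of_ne_of_ne e1 e2, Equiv.swap_apply_of_ne_of_ne e3 e4,
    Equiv.swap_apply_of_ne_of_ne e1.symm e3.symm, Equiv.swap_apply_of_ne_of_ne e2.symm e4.symm,
    map_add, map_smul, T_comm hg i j hij]
  module

theorem ybCoeff_cocycle (t : K) {x y z : K} (hx : x ≠ 0) (hy : y ≠ 0) (hxy : y ≠ x)
    (hyz : z ≠ y) (hxz : z ≠ x) :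
    ybCoeff t (z / x) * (t - 1 + ybCoeff t (z / y) + ybCoeff t (y / x))
      = ybCoeff t (y / x) * ybCoeff t (z / y) := by
  have h1 := sub_ne_zero.2 hxy
  have h2 := sub_ne_zero.2 hyz
  have h3 := sub_ne_zero.2 hxz
  unfold ybCoeff
  field_simp
  ring

/-- The Yang–Baxter relation. -/
theorem ybStep_braid (hg : Generic q t μ) (i j : Fin n) (hij : (i : ℕ) + 1 = j)
    (α : Fin (n + 1) → ℕ) (S : RSYT μ n) (f : PV K μ n)
    (h01 : α i.castSucc < α i.succ) (h12 : α i.succ < α j.succ) :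
    ybStep q t (swapAt (swapAt α i) j) S i (ybStep q t (swapAt α i) S j (ybStep q t α S i f))
      = ybStep q t (swapAt (swapAt α j) i) S j
        (ybStep q t (swapAt α j) S i (ybStep q t α S j f)) := by
  have hj : j.castSucc = i.succ := by simp [Fin.ext_iff, ← hij]
  have n12 : j.succ ≠ i.succ := by simp only [Ne, Fin.ext_iff, Fin.val_succ]; omega
  have n02 : i.castSucc ≠ j.succ := by
    simp only [Ne, Fin.ext_iff, Fin.val_castSucc, Fin.val_succ]; omega
  have n01 : i.castSucc ≠ i.succ := (Fin.castSucc_lt_succ).ne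
  have h1 := zeta_ne hg α S h01
  have h2 := zeta_ne hg α S h12
  have h3 := zeta_ne hg α S (h01.trans h12)
  have hc := ybCoeff_cocycle t (zeta_ne_zero hg α S i.castSucc) (zeta_ne_zero hg α S i.succ)
    h1 h2 h3
  have hjα : α j.castSucc ≠ α j.succ := by rw [hj]; exact h12.ne
  have s1 : swapAt α i j.castSucc ≠ swapAt α i j.succ := by
    rw [hj, swapAt_succ, swapAt_of_ne α i n02.symm n12]; omega
  have s2 : swapAt α j i.castSucc ≠ swapAt α j i.succ := by
    rw [← hj, swapAt_castSucc, swapAt_of_ne α j (by rw [hj]; exact n01) n02]; omega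
  simp only [ybStep_eq, zeta_swapAt _ S j s1, zeta_swapAt _ S i s2, zeta_swapAt α S i h01.ne,
    zeta_swapAt α S j hjα, hj, Equiv.swap_apply_left, Equiv.swap_apply_right,
    Equiv.swap_apply_of_ne_of_ne n02.symm n12, Equiv.swap_apply_of_ne_of_ne n01 n02,
    map_add, map_smul, T_braid hg i j hij, T_quad hg]
  match_scalars <;> first | ring1 | linear_combination hc | linear_combination -hc

/-- Path independence. The step at i is compared with the step by which `M` is defined at β; by
induction both continue to a common earlier node, and the relations between steps close the diagram.
-/
theorem M_eq_ybStep (hg : Generic q t μ) (S : RSYT μ n) (β : Fin (n + 1) → ℕ) :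
    ∀ i : Fin n, β i.succ < β i.castSucc →
      M q t β S = ybStep q t (swapAt β i) S i (M q t (swapAt β i) S) := by
  induction β using composition_induction with
  | h β ih1 ih2 =>
    intro i hi
    by_cases hl : β (Fin.last n) = 0
    · have h0 : β ≠ 0 := by rintro rfl; simp at hi
      obtain ⟨k, hk, hk'⟩ := exists_last_ne_zero β h0 hl
      have hk'' := hk' k.succ Fin.castSucc_lt_succ
      have hik : i ≤ k := by
        by_contra hlt
        have := hk' i.castSucc (Fin.castSucc_lt_castSucc_iff.2 (not_le.1 hlt))
        omega
      rcases eq_or_lt_of_le hik with rfl | hik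
      · exact M_of_last_ne_zero β S hl i hk hk'
      have hswk : β k.succ < β k.castSucc := by omega
      have hβ := M_of_last_ne_zero (q := q) (t := t) β S hl k hk hk'
      have hγ := ih2 _ (sum_swapAt β k) (weight_swapAt_lt β k hswk)
      have hα := ih2 _ (sum_swapAt β i) (weight_swapAt_lt β i hi)
      have e1 : k.succ ≠ i.castSucc := by
        simp only [Ne, Fin.ext_iff, Fin.val_castSucc, Fin.val_succ, Fin.lt_def] at hik ⊢; omega
      have e2 : k.succ ≠ i.succ := by
        simp only [Ne, Fin.ext_iff, Fin.val_succ, Fin.lt_def] at hik ⊢; omega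
      have e3 : k.castSucc ≠ i.castSucc := by
        simp only [Ne, Fin.ext_iff, Fin.val_castSucc, Fin.lt_def] at hik ⊢; omega
      -- Distant positions give a commuting square from the common node `δ`.
      rcases Nat.lt_or_ge (i + 1) k with hlt | hge
      · have e4 : k.castSucc ≠ i.succ := by
          simp only [Ne, Fin.ext_iff, Fin.val_castSucc, Fin.val_succ]; omega
        rw [hβ, hγ i (by rwa [swapAt_of_ne _ _ e3.symm e1.symm, swapAt_of_ne _ _ e4.symm e2.symm]),
          hα k (by rwa [swapAt_of_ne _ _ e3 e4, swapAt_of_ne _ _ e1 e2]),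
          ← swapAt_comm β i k hlt]
        set δ := swapAt (swapAt β i) k with hδ
        have hδk : swapAt δ k = swapAt β i := swapAt_swapAt _ _
        have hδi : swapAt δ i = swapAt β k := by rw [hδ, swapAt_comm β i k hlt, swapAt_swapAt]
        rw [← hδk, ← hδi]
        refine ybStep_comm hg i k hlt δ S _ ?_ ?_
        · rw [hδ, swapAt_of_ne _ _ e3.symm e1.symm, swapAt_of_ne _ _ e4.symm e2.symm,
            swapAt_castSucc, swapAt_succ]
          omega
        · rw [hδ, swapAt_castSucc, swapAt_succ, swapAt_of_ne _ _ e3 e4, swapAt_of_ne _ _ e1 e2]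
          omega
      -- Adjacent positions give the Yang–Baxter hexagon: at `ε` the three entries are 0 < β_{i+1} <
      -- β_i, and both ways of reversing them lead to β.
      · have hik1 : (i : ℕ) + 1 = k := le_antisymm hik hge
        have hki : k.castSucc = i.succ := by simp [Fin.ext_iff, ← hik1]
        have v1 : swapAt β k i.castSucc = β i.castSucc := swapAt_of_ne _ _ e3.symm e1.symm
        have v2 : swapAt β k i.succ = 0 := by rw [← hki, swapAt_castSucc, hk'']
        have v3 : swapAt β k k.succ = β i.succ := by rw [swapAt_succ, hki]
        have v4 : swapAt β i k.succ = 0 := by rw [swapAt_of_ne _ _ e1 e2, hk'']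
        have v5 : swapAt β i k.castSucc = β i.castSucc := by rw [hki, swapAt_succ]
        have v6 : swapAt β i i.castSucc = β i.succ := swapAt_castSucc _ _
        have hk0 : β i.succ ≠ 0 := hki ▸ hk
        have w1 := weight_swapAt_lt β k hswk
        have w2 := weight_swapAt_lt (swapAt β k) i (by omega)
        have w3 := weight_swapAt_lt β i hi
        have w4 := weight_swapAt_lt (swapAt β i) k (by omega)
        have s1 := sum_swapAt β k
        have s2 := sum_swapAt (swapAt β k) i
        have s3 := sum_swapAt β i
        have s4 := sum_swapAt (swapAt β i) k
        have hδ := ih2 (swapAt (swapAt β k) i) (s2.trans s1) (w2.trans w1) k (by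
          rw [hki, swapAt_succ, v1, swapAt_of_ne _ _ e1 e2, v3]; exact hi)
        have hε := ih2 (swapAt (swapAt β i) k) (s4.trans s3) (w4.trans w3) i (by
          rw [← hki, swapAt_castSucc, v4, swapAt_of_ne _ _ e3.symm e1.symm, v6]; omega)
        rw [hβ, hγ i (by omega), hδ, hα k (by omega), hε, ← swapAt_braid β i k hik1]
        set ε := swapAt (swapAt (swapAt β i) k) i with hεdef
        have r1 : swapAt ε i = swapAt (swapAt β i) k := swapAt_swapAt _ _
        have r2 : swapAt (swapAt ε i) k = swapAt β i := by rw [r1, swapAt_swapAt]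
        have r3 : swapAt ε k = swapAt (swapAt β k) i := by
          rw [hεdef, swapAt_braid β i k hik1, swapAt_swapAt]
        have r4 : swapAt (swapAt ε k) i = swapAt β k := by rw [r3, swapAt_swapAt]
        rw [← r3, ← r1, ← r4, ← r2]
        refine (ybStep_braid hg i k hik1 ε S _ ?_ ?_).symm
        · rw [hεdef, swapAt_castSucc, swapAt_succ, ← hki, swapAt_castSucc, v4,
            swapAt_of_ne _ _ e3.symm e1.symm, v6]
          omega
        · rw [hεdef, swapAt_succ, swapAt_of_ne _ _ e3.symm e1.symm, v6, swapAt_of_ne _ _ e1 e2,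
            swapAt_succ, v5]
          exact hi
    · have hβ := affine_affineInv β hl
      set γ := affineInv β with hγ
      have ihγ := ih1 γ (sum_affineInv_lt β hl)
      -- Removing one affine step turns s_i into s_{i+1}. At i = N-1 there is no s_N, but the last
      -- two entries of β are nonzero, so two affine steps are removed and s_1 appears.
      by_cases hin : (i : ℕ) + 1 = n
      · have hil : i.succ = Fin.last n := by simp [Fin.ext_iff, hin]
        have hγl : γ (Fin.last n) ≠ 0 := by
          have := affine_castSucc γ i
          rw [hβ, hil] at this
          omega
        have hγγ := affine_affineInv γ hγl
        set δ := affineInv γ with hδ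
        have ihδ := ih1 δ ((sum_affineInv_lt γ hγl).trans (sum_affineInv_lt β hl))
        have hn : 0 < n := by omega
        have hc0 : (⟨0, hn⟩ : Fin n).castSucc = 0 := rfl
        have hδi : δ (⟨0, hn⟩ : Fin n).succ < δ (⟨0, hn⟩ : Fin n).castSucc := by
          rw [← hβ, affine_castSucc, hil, affine_last, ← hγγ, affine_last, ← hc0,
            affine_castSucc] at hi
          omega
        rw [← hβ, ← hγγ, M_affine, M_affine, ihδ ⟨0, hn⟩ hδi,
          ← affine_affine_swapAt δ ⟨0, hn⟩ i rfl hin,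
          M_affine, M_affine, ybStep_affineStep_affineStep hg ⟨0, hn⟩ i rfl hin]
      · have hj : (i : ℕ) + 1 < n := by omega
        have hji : i.succ = (⟨i + 1, hj⟩ : Fin n).castSucc := rfl
        have hγj : γ (⟨i + 1, hj⟩ : Fin n).succ < γ (⟨i + 1, hj⟩ : Fin n).castSucc := by
          have h1 := affine_castSucc γ i
          have h2 := affine_castSucc γ ⟨i + 1, hj⟩
          rw [hβ] at h1 h2
          rw [← h2, ← hji, ← h1]
          exact hi
        rw [← hβ, M_affine, ihγ _ hγj, ← affine_swapAt γ i ⟨i + 1, hj⟩ rfl, M_affine,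
          ybStep_affineStep hg i ⟨i + 1, hj⟩ rfl]

end Macdonald

/-! ### Adjointness, orthogonality and the two norm formulas. -/

section Norms

variable {K : Type*} [Field K] {μ : YoungDiagram} {n : ℕ} {q t : K}
  {B : LinearMap.BilinForm K (PV K μ n)}

/-- The recursion T_i ξ_{i+1} T_i is palindromic, so self-adjointness descends from ξ_N. -/
theorem BF2.xi_adjoint (hB : BF2 q t B) (k : Fin (n + 1)) :
    ∀ f g, B (xi q t k f) g = B f (xi q t k g) := by
  induction k using Fin.reverseInduction with
  | last => rw [xi_last]; exact hB.cherednik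
  | cast i ih =>
    intro f g
    rw [xi_castSucc, xi_castSucc, map_smul, LinearMap.smul_apply, map_smul, hB.hecke, ih, hB.hecke]

theorem BF2.orthogonal (hB : BF2 q t B) {k : Fin (n + 1)} {a b : K} {f g : PV K μ n}
    (hf : xi q t k f = a • f) (hg : xi q t k g = b • g) (hab : a ≠ b) : B f g = 0 := by
  have h := hB.xi_adjoint k f g
  rw [hf, hg, map_smul, LinearMap.smul_apply, map_smul, smul_eq_mul, smul_eq_mul] at h
  have : (a - b) * B f g = 0 := by linear_combination h
  exact (mul_eq_zero.1 this).resolve_left (sub_ne_zero.2 hab)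

/-- The norm along a step `s_i`. -/
theorem BF2.norm_swapAt (hB : BF2 q t B) (hg : Generic q t μ) (S : RSYT μ n)
    (α : Fin (n + 1) → ℕ) (i : Fin n) (hi : α i.castSucc < α i.succ) :
    B (M q t (swapAt α i) S) (M q t (swapAt α i) S)
      = u t (zeta q t α S i.succ / zeta q t α S i.castSucc) * B (M q t α S) (M q t α S) := by
  have hM := M_eq_ybStep hg S (swapAt α i) i (by rwa [swapAt_castSucc, swapAt_succ])
  rw [swapAt_swapAt, ybStep_eq] at hM
  have h0 := zeta_ne_zero hg α S i.castSucc
  have hne := zeta_ne hg α S hi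
  have hz : zeta q t α S i.succ / zeta q t α S i.castSucc ≠ 1 := by
    rwa [Ne, div_eq_one_iff_eq h0]
  have horth : B (M q t α S) (M q t (swapAt α i) S) = 0 := by
    refine hB.orthogonal (isSpectral_M hg S α i.castSucc)
      (isSpectral_M hg S (swapAt α i) i.castSucc) ?_
    rw [zeta_swapAt α S i hi.ne, Equiv.swap_apply_left]
    exact hne.symm
  generalize zeta q t α S i.succ / zeta q t α S i.castSucc = z at *
  generalize M q t (swapAt α i) S = g at *
  generalize M q t α S = f at *
  have hT : T t i f = g - ybCoeff t z • f := by rw [hM, add_sub_cancel_right]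
  have h1 : B g g = B f (T t i g) := by
    conv_lhs => lhs; rw [hM]
    rw [map_add, map_smul, LinearMap.add_apply, LinearMap.smul_apply, horth, smul_zero, add_zero,
      hB.hecke]
  -- Pairing with f removes the g-term by orthogonality; the f-coefficient is u(z).
  have h2 : T t i g = (t - 1 + ybCoeff t z) • g
      + (t - ybCoeff t z * (t - 1 + ybCoeff t z)) • f := by
    conv_lhs => rw [hM]
    rw [map_add, map_smul, T_quad hg, hT]
    module
  rw [h1, h2, map_add, map_smul, map_smul, horth, smul_zero, zero_add, smul_eq_mul]
  congr 1
  have := sub_ne_zero.2 hz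
  have := sub_ne_zero.2 hz.symm
  unfold ybCoeff u
  field_simp
  ring

theorem BF2.norm_plus (hB : BF2 q t B) (hg : Generic q t μ) (S : RSYT μ n)
    (α : Fin (n + 1) → ℕ) :
    B (M q t (plus α) S) (M q t (plus α) S) = E q t α S * B (M q t α S) (M q t α S) := by
  -- The measure is ∑ k α_k with positions counted from 0, which drops when an ascent is swapped.
  -- The bound `hle` keeps the truncated subtraction faithful.
  have key : ∀ (d : ℕ) (α : Fin (n + 1) → ℕ),
      n * ∑ k, α k - ∑ k : Fin (n + 1), α k * (n - (k : ℕ)) = d →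
      B (M q t (plus α) S) (M q t (plus α) S) = E q t α S * B (M q t α S) (M q t α S) := by
    intro d
    induction d using Nat.strong_induction_on with
    | _ d ih =>
      intro α hd
      by_cases ha : Antitone α
      · rw [plus_of_antitone α ha, E_of_antitone α S ha, one_mul]
      · rw [Fin.antitone_iff_succ_le] at ha
        push Not at ha
        obtain ⟨i, hi⟩ := ha
        have hw := weight_swapAt_lt (swapAt α i) i (by rwa [swapAt_castSucc, swapAt_succ])
        rw [swapAt_swapAt] at hw
        have hs := sum_swapAt α i
        have hle : ∑ k : Fin (n + 1), swapAt α i k * (n - (k : ℕ)) ≤ n * ∑ k, swapAt α i k := by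
          rw [mul_sum]
          refine sum_le_sum fun k _ => ?_
          rw [mul_comm]
          exact Nat.mul_le_mul_right _ (Nat.sub_le _ _)
        have := ih _ (by rw [← hd, ← hs]; omega) (swapAt α i) rfl
        rw [plus_swapAt, hB.norm_swapAt hg S α i hi] at this
        rw [this, E_eq_mul_E_swapAt hg α S i hi]
        ring
  exact key _ α rfl

theorem BF2.heckeD_adjoint (hB : BF2 q t B) (f g : PV K μ n) :
    B (heckeD (T t) f) g = B f (heckeW (T t) g) := by
  have : ∀ (l : List (Fin n)) (f g : PV K μ n),
      B ((l.map (T t)).prod f) g = B f ((l.map (T t)).reverse.prod g) := by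
    intro l
    induction l with
    | nil => intro f g; simp
    | cons a l ih =>
      intro f g
      simp only [List.map_cons, List.prod_cons, List.reverse_cons, List.prod_append,
        List.prod_nil, mul_one, Module.End.mul_apply]
      rw [hB.hecke, ih]
  exact this _ f g

theorem dunklLast_of_eigenvector {a : K} {f : PV K μ n}
    (h : xiLast q t (mulXLast f) = a • mulXLast f) :
    dunklLast q t (mulXLast f) = (1 - a) • f := by
  have hdiv : ∀ f : PV K μ n,
      TensorProduct.map (divXLast K n) LinearMap.id (mulXLast f : PV K μ n) = f := by
    intro f
    induction f using TensorProduct.induction_on with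
    | zero => simp
    | add f g hf hg => simp only [map_add, hf, hg]
    | tmul p v => exact congrArg (· ⊗ₜ[K] v) (MvPolynomial.X_mul_divMonomial _ p)
  rw [dunklLast, LinearMap.comp_apply, LinearMap.sub_apply, Module.End.one_apply, h, map_sub,
    map_smul, hdiv]
  module

/-- The argument is chosen to cancel the inverses in w^*; what remains is t^{N-1} ξ_1 f. -/
theorem wStar_heckeW (hg : Generic q t μ) (f : PV K μ n) :
    wStar q t (heckeW (T t) f) = heckeD (T t) (w q t f) := by
  have h : TinvDesc t (heckeW (T t) f) = f :=
    LinearMap.congr_fun (heckeD_mul_heckeW (heckeInv t (T t)) (T t)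
      ((isAffineHecke (n := n) hg).inv_mul hg.t_ne_zero)) f
  rw [wStar, Module.End.mul_apply, Module.End.mul_apply, h]
  rfl

/-- The norm along the affine step. -/
theorem BF2.norm_affine (hB : BF2 q t B) (hg : Generic q t μ) (S : RSYT μ n)
    (α : Fin (n + 1) → ℕ) :
    B (M q t (affine α) S) (M q t (affine α) S)
      = (1 - q ^ (α 0 + 1) * t ^ S.content (rank α 0)) / (1 - q)
        * B (M q t α S) (M q t α S) := by
  -- Genericity with exponents a = 1, b = 0.
  have hq1 : 1 - q ≠ 0 := by
    have := hg.ne_one 1 _ _ (S.pos_mem 0) (S.pos_mem 0) (Or.inl one_ne_zero)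
    rw [sub_self, zpow_zero, mul_one, pow_one] at this
    exact sub_ne_zero.2 (Ne.symm this)
  have hz : q ^ (α 0 + 1) * t ^ S.content (rank α 0) = q * zeta q t α S 0 := by
    rw [zeta, pow_succ']; ring
  have hf := isSpectral_M hg S α 0
  have hgl := isSpectral_M hg S (affine α) (Fin.last n)
  rw [xi_last, zeta_affine_last, M_affine] at hgl
  have h0 := zeta_ne_zero hg α S 0
  rw [hz, M_affine]
  generalize M q t α S = f at *
  generalize zeta q t α S 0 = z at *
  have htn := pow_ne_zero n hg.t_ne_zero
  have hDw : heckeD (T t) (w q t f) = (t ^ n * z) • f := by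
    have h : xi q t 0 f = (t⁻¹) ^ n • heckeD (T t) (w q t f) :=
      LinearMap.congr_fun ((isAffineHecke (n := n) hg).xi_zero hg.t_ne_zero) f
    rw [mul_smul, ← hf, h, smul_smul, ← mul_pow, mul_inv_cancel₀ hg.t_ne_zero, one_pow, one_smul]
  have hd := hB.dunkl (affineStep q t f) (heckeW (T t) f)
  have hdl : dunklLast q t (affineStep q t f) = (1 - q * z) • w q t f :=
    dunklLast_of_eigenvector hgl
  have hr : mulXLast (w q t ((t ^ n * z) • f)) = (t ^ n * z) • affineStep q t f := by
    rw [map_smul, map_smul]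
    rfl
  -- Moving the T_i across the form on the left side produces ξ_1 f again, so both sides contain the
  -- same nonzero factor t^n z.
  rw [hdl, wStar_heckeW hg, hDw, hr, map_smul, map_smul, LinearMap.smul_apply,
    ← hB.heckeD_adjoint, hDw, map_smul, LinearMap.smul_apply, smul_eq_mul, smul_eq_mul,
    smul_eq_mul] at hd
  rw [div_mul_eq_mul_div, eq_div_iff hq1]
  apply mul_left_cancel₀ (mul_ne_zero htn h0)
  linear_combination -hd

end Norms

end VVMac

theorem mainTheorem9 {K : Type*} [Field K] (n : ℕ) (μ : YoungDiagram) (hμ : μ.card = n + 1)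
    (q t : K) (hq : q ≠ 0) (ht : t ≠ 0)
    (hgen : ∀ (a : ℕ) (b : ℤ), a ≠ 0 ∨ b ≠ 0 →
      |b| ≤ (μ.rowLen 0 : ℤ) + (μ.colLen 0 : ℤ) - 2 → q ^ a * t ^ b ≠ 1)
    (B : LinearMap.BilinForm K (VVMac.PV K μ n)) (hB : VVMac.BF2 q t B)
    (α : Fin (n + 1) → ℕ) (S : VVMac.RSYT μ n) :
    B (VVMac.M q t (VVMac.plus α) S) (VVMac.M q t (VVMac.plus α) S)
        = VVMac.E q t α S * B (VVMac.M q t α S) (VVMac.M q t α S) ∧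
      B (VVMac.M q t (VVMac.affine α) S) (VVMac.M q t (VVMac.affine α) S)
        = (1 - q ^ (α 0 + 1) * t ^ S.content (VVMac.rank α 0)) / (1 - q)
          * B (VVMac.M q t α S) (VVMac.M q t α S) :=
  have hg := VVMac.generic_of_bounded hq ht hgen
  ⟨hB.norm_plus hg S α, hB.norm_affine hg S α⟩
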